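/- Let $M$ be a monoid. For a finite generating set $A$ of $M$, the right Cayley graph of $M$ with respect to $A$ is the directed graph with vertex set $M$ and an edge from $m$ to $ma$ for each $m\in M$, $a\in A$; $d(x,y)\in\mathbb N\cup\{\infty\}$ denotes the length of a shortest directed path from $x$ to $y$ ($\infty$ if there is none), and a directed path of length $n$ from $x$ to $y$ is a geodesic if $n=d(x,y)$. A geodesic triangle is a triple $(p,q,r)$ of geodesics such that $p$ ends where $q$ starts, $p$ and $r$ have the same start, and $q$ and $r$ have the same end. For $\delta\ge 0$ it is $\delta$-thin if every vertex $x$ of $r$ satisfies $d(y,x)\le\delta$ for some vertex $y$ of $p$ or $d(x,y)\le\delta$ for some vertex $y$ of $q$; every vertex $x$ of $p$ satisfies $d(y,x)\le\delta$ for some vertex $y$ of $r$ or $d(x,y)\le\delta$ for some vertex $y$ of $q$; and every vertex $x$ of $q$ satisfies $d(y,x)\le\delta$ for some vertex $y$ of $p$ or $d(x,y)\le\delta$ for some vertex $y$ of $r$. The monoid $M$ is strongly hyperbolic if for some finite generating set $A$ and some real $\delta\ge 0$ all geodesic triangles in its right Cayley graph with respect to $A$ are $\delta$-thin. It has bounded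 indegree if for some (equivalently, every) finite generating set $A$ there is $\alpha\in\mathbb N$ such that there are no $a\in A$ and $\alpha+1$ distinct elements $x_0,\dots,x_\alpha\in M$ with $x_0a=x_1a=\dots=x_\alpha a$. For $x,y\in M$ write $x\le_{\mathcal J}y$ if $MxM\subseteq MyM$, and $x\mathrel{\mathcal D}y$ if there is $c\in M$ with $Mx=Mc$ and $cM=yM$. Theorem. Let $M$ be a finitely generated, left cancellative monoid of bounded indegree which is strongly hyperbolic. Then for every finite generating set $A$ of $M$, the following problem is in $\mathbf{NP}$: given words $u,v\in A^*$, decide whether $u\le_{\mathcal J}v$ holds for the elements of $M$ that they represent. If, moreover, $M$ is cancellative, then for every finite generating set $A$ of $M$, the following problem is in $\mathbf{NP}$: given words $u,v\in A^*$, decide whether $u\mathrel{\mathcal D}v$ holds for the elements of $M$ that they represent. -/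

import Mathlib

open scoped NNReal ENNReal

universe u

namespace StrongHyp

section DirectedGraphs

variable {V : Type u}

/-- A directed path `[x₀, …, xₙ]` of length `n` in a directed graph. -/
structure DiPath (G : Digraph V) where
  length : ℕ
  vert : Fin (length + 1) → V
  adj : ∀ i : Fin length, G.Adj (vert i.castSucc) (vert i.succ)

namespace DiPath

variable {G : Digraph V}

/-- The start vertex of a path. -/
def source (p : DiPath G) : V := p.vert 0

/-- The end vertex of a path. -/
def target (p : DiPath G) : V := p.vert (Fin.last p.length)

/-- The set of vertices visited by a path. -/
def support (p : DiPath G) : Set V := Set.range p.vert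

end DiPath

/-- The directed distance: the least length of a directed path from `x` to `y`, and `⊤` if there
is no such path. -/
noncomputable def dist (G : Digraph V) (x y : V) : ℕ∞ :=
  ⨅ p : {p : DiPath G // p.source = x ∧ p.target = y}, (p.1.length : ℕ∞)

/-- A path is a geodesic if its length is the distance from its start to its end. -/
def DiPath.IsGeodesic {G : Digraph V} (p : DiPath G) : Prop :=
  (p.length : ℕ∞) = dist G p.source p.target

/-- The union of the out-balls of radius `δ` around the points of `S`. -/
def outBall (G : Digraph V) (δ : ℝ≥0) (S : Set V) : Set V :=
  {y | ∃ x ∈ S, (dist G x y : ℝ≥0∞) ≤ δ}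

/-- The union of the in-balls of radius `δ` around the points of `S`. -/
def inBall (G : Digraph V) (δ : ℝ≥0) (S : Set V) : Set V :=
  {y | ∃ x ∈ S, (dist G y x : ℝ≥0∞) ≤ δ}

/-- `(p, q, r)` is a geodesic triangle: three geodesics such that `p ∘ q` is defined and parallel
to `r`. -/
structure IsGeodesicTriangle {G : Digraph V} (p q r : DiPath G) : Prop where
  geodesic_left : p.IsGeodesic
  geodesic_right : q.IsGeodesic
  geodesic_hyp : r.IsGeodesic
  composable : p.target = q.source
  source_eq : p.source = r.source
  target_eq : q.target = r.target

/-- A triangle is `δ`-thin if each side is contained in the union of the out-balls of radius `δ`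
around the points of the side that meets its start and the in-balls of radius `δ` around the
points of the side that meets its end. -/
structure IsThin {G : Digraph V} (δ : ℝ≥0) (p q r : DiPath G) : Prop where
  thin_hyp : r.support ⊆ outBall G δ p.support ∪ inBall G δ q.support
  thin_left : p.support ⊆ outBall G δ r.support ∪ inBall G δ q.support
  thin_right : q.support ⊆ outBall G δ p.support ∪ inBall G δ r.support

/-- A directed graph is strongly `δ`-hyperbolic if all its geodesic triangles are `δ`-thin. -/
def StronglyDeltaHyperbolic (G : Digraph V) (δ : ℝ≥0) : Prop :=
  ∀ p q r : DiPath G, IsGeodesicTriangle p q r → IsThin δ p q r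

end DirectedGraphs

section Monoids

variable {M : Type u} [Monoid M]

/-- The finite set `A` generates `M` as a monoid. -/
def Generates (A : Finset M) : Prop := Submonoid.closure (A : Set M) = ⊤

/-- The right Cayley graph of `M` with respect to `A`: an edge from `m` to `m * a` for each
`a ∈ A`. (Distances, and hence all notions above, do not see multiplicities of edges.) -/
def cayleyGraph (A : Finset M) : Digraph M where
  Adj m n := ∃ a ∈ A, m * a = n

variable (M) in
/-- `M` is strongly hyperbolic: for some finite generating set `A` and some `δ ≥ 0`, the right
Cayley graph is strongly `δ`-hyperbolic. -/
def StronglyHyperbolic : Prop :=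
  ∃ A : Finset M, Generates A ∧ ∃ δ : ℝ≥0, StronglyDeltaHyperbolic (cayleyGraph A) δ

/-- The indegree of `M` with respect to `A` is bounded by `k`: there are no generator `a ∈ A` and
`k + 1` distinct elements `x₀, …, x_k` with `x₀ a = ⋯ = x_k a`. -/
def IndegreeBoundedBy (A : Finset M) (k : ℕ) : Prop :=
  ∀ a ∈ A, ¬ ∃ x : Fin (k + 1) → M, Function.Injective x ∧ ∀ i j, x i * a = x j * a

variable (M) in
/-- `M` has bounded indegree (with respect to some, equivalently every, finite generating set). -/
def BoundedIndegree : Prop :=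
  ∃ A : Finset M, Generates A ∧ ∃ k : ℕ, IndegreeBoundedBy A k

/-- The principal right ideal `bM`. -/
def rightIdeal (b : M) : Set M := {x | ∃ t, b * t = x}

/-- The principal left ideal `Mb`. -/
def leftIdeal (b : M) : Set M := {x | ∃ s, s * b = x}

/-- The principal two-sided ideal `MbM`. -/
def twoSidedIdeal (b : M) : Set M := {x | ∃ s t, s * b * t = x}

/-- Green's pre-order `a ≤_J b`. -/
def GreenJLE (a b : M) : Prop := twoSidedIdeal a ⊆ twoSidedIdeal b

/-- Green's relation `L`. -/
def GreenL (a b : M) : Prop := leftIdeal a = leftIdeal b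

/-- Green's relation `R`. -/
def GreenR (a b : M) : Prop := rightIdeal a = rightIdeal b

/-- Green's relation `D`. -/
def GreenD (a b : M) : Prop := ∃ c, GreenL a c ∧ GreenR c b

/-- The element of `M` represented by a word over `A`. -/
def eval {A : Finset M} (w : List A) : M := (w.map Subtype.val).prod

end Monoids

section NP

/-- A nondeterministic Turing machine with finitely many (at least one) two-way infinite tapes
and input alphabet `α`. The tape alphabet is `Γ`, with blank symbol `default`; the transition
relation `next` maps a state and the scanned symbols to the set of permitted combinations of a new
state and, for each tape, a symbol to write followed by a move (`none` means no move). -/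
structure NTM (α : Type u) where
  numExtraTapes : ℕ
  Γ : Type
  [inhabitedΓ : Inhabited Γ]
  [finiteΓ : Finite Γ]
  Q : Type
  [finiteQ : Finite Q]
  input : α ↪ Γ
  input_ne_blank : ∀ a, input a ≠ default
  start : Q
  accept : Q
  next : Q → (Fin (numExtraTapes + 1) → Γ) →
    Set (Q × (Fin (numExtraTapes + 1) → Γ × Option Turing.Dir))

namespace NTM

variable {α : Type u} (N : NTM α)

instance : Inhabited N.Γ := N.inhabitedΓ

/-- A configuration: the current state and the tapes with their head positions. -/
structure Cfg where
  state : N.Q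
  tape : Fin (N.numExtraTapes + 1) → Turing.Tape N.Γ

variable {N} in
/-- Write a symbol at the head of a tape, then move the head. -/
def act (T : Turing.Tape N.Γ) (a : N.Γ × Option Turing.Dir) : Turing.Tape N.Γ :=
  match a.2 with
  | none => T.write a.1
  | some d => (T.write a.1).move d

/-- One step of computation. -/
def Step (c c' : N.Cfg) : Prop :=
  ∃ a : Fin (N.numExtraTapes + 1) → N.Γ × Option Turing.Dir,
    (c'.state, a) ∈ N.next c.state (fun i => (c.tape i).head) ∧
      ∀ i, c'.tape i = act (c.tape i) (a i)

/-- There is a computation of exactly `n` steps between two configurations. -/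
def StepsTo : ℕ → N.Cfg → N.Cfg → Prop
  | 0, c, c' => c = c'
  | n + 1, c, c' => ∃ c₁, N.Step c c₁ ∧ StepsTo n c₁ c'

/-- The initial configuration: the input word is on the first tape with the head on its first
letter, and all other tapes are blank. -/
def init (w : List α) : N.Cfg where
  state := N.start
  tape i := if i = 0 then Turing.Tape.mk₁ (w.map N.input) else Turing.Tape.mk₁ []

/-- Some computation of exactly `n` steps on the input `w` ends in the accepting state. -/
def AcceptsIn (w : List α) (n : ℕ) : Prop :=
  ∃ c : N.Cfg, N.StepsTo n (N.init w) c ∧ c.state = N.accept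

end NTM

/-- A language is in NP if some nondeterministic Turing machine and some polynomial `f` are such
that every word `w` of the language has an accepting computation of at most `f(|w|)` steps, and
words outside the language have no accepting computation. -/
def InNP {α : Type u} (L : Language α) : Prop :=
  ∃ (N : NTM α) (f : Polynomial ℕ), ∀ w : List α,
    (w ∈ L → ∃ n ≤ f.eval w.length, N.AcceptsIn w n) ∧ (∀ n, N.AcceptsIn w n → w ∈ L)

/-- The word `u#v` encoding a pair of words; `none` is the separator `#`. -/
def pairWord {α : Type u} (u v : List α) : List (Option α) :=
  u.map some ++ none :: v.map some

/-- A binary relation on words, as a language: the set of the words `u#v` with `R u v`. -/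
def relLanguage {α : Type u} (R : List α → List α → Prop) : Language (Option α) :=
  {w | ∃ u v, R u v ∧ w = pairWord u v}

/-- The binary relation `R` on `M`, given on words over the finite set `A`, is in NP: the problem,
given words `u`, `v` over `A`, whether `R` holds between the elements they represent. -/
def RelInNP {M : Type u} [Monoid M] (A : Finset M) (R : M → M → Prop) : Prop :=
  InNP (relLanguage fun u v : List A => R (eval u) (eval v))

end NP

end StrongHyp

/-!
The theorem rests on three facts about a left cancellative monoid `M` of bounded indegree whose
right Cayley graph for a finite generating set `B` has thin geodesic triangles.

*Quadratic Dehn function* (`exists_derives_of_eval_eq`). Bounded indegree means that the equation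
`p z = z'` with `z`, `z'` of bounded length has boundedly many solutions `p`, so that geodesic
words `p` solving it have bounded length. Let `g` be geodesic, `b` a generator and `h` a geodesic
word for `gb`. By thinness every point of `h` is reached from some point of `g` by a bounded word.
By left cancellation the cell between two consecutive such words is a relation of `M`; it involves
bounded words and a segment of the geodesic `g`, which is therefore bounded as well. So `h` is
derived from `gb` by linearly many bounded relations, and letter by letter any word is reduced to a
geodesic one by quadratically many.

*Short witnesses* (`exists_minimalWitness_length_le`). Let `N` be a submonoid closed under taking
factors, and suppose that `s v t = u` for some `s`, `t` in `N`. If `s` and `t` are chosen minimal,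
their lengths are linear in those of `u` and `v`. For in the quadrilateral with sides `s`, `v`,
`t`, `u` every point of `s` is near `v`, near `u`, or joined to a point of `t` by a fork of two
bounded words. Only linearly many points are near `u` or `v`, since balls of fixed radius, in-balls
included, are bounded. If the same fork occurs at two points, left cancellation gives an equation
by which a factor of `s` can be cut out together with one of `t`, or traded for one of `t`,
contradicting minimality.

*Machines* (`StackMachine.inNP`, `relInNP_witness`). A nondeterministic machine with several stacks
guesses `s` and `t`, rewrites `s v t` by bounded relations and compares the result with `u`; it is
simulated by a Turing machine with one tape for each stack.

Finally `u ≤_J v` says that `s v t = u` is solvable in `M`, and if `M` is cancellative, `u D v` says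
that it is solvable in the group of units; both are submonoids closed under taking factors.
-/

namespace StrongHyp

/-! ### Words and paths in the Cayley graph -/

section Words

variable {M : Type u} [Monoid M] {A : Finset M}

@[simp] lemma eval_nil : eval ([] : List A) = 1 := rfl

@[simp] lemma eval_append (v w : List A) : eval (v ++ w) = eval v * eval w := by
  simp [eval]

lemma eval_singleton (a : A) : eval [a] = (a : M) := by
  simp [eval]

lemma Generates.exists_eval_eq (hA : Generates A) (m : M) : ∃ w : List A, eval w = m := by
  have hm : m ∈ Submonoid.closure (A : Set M) := by
    rw [show Submonoid.closure (A : Set M) = ⊤ from hA]; trivial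
  obtain ⟨l, hl, rfl⟩ := Submonoid.exists_list_of_mem_closure hm
  exact ⟨l.attach.map fun x => ⟨x.1, hl x.1 x.2⟩, by simp [eval, Function.comp_def]⟩

/-- `y` lies at directed distance at most `n` from `x`. -/
def Near (A : Finset M) (n : ℕ) (x y : M) : Prop :=
  ∃ z : List A, z.length ≤ n ∧ x * eval z = y

/-- A word is geodesic if no shorter word represents the same element. -/
def IsGeodesicWord (w : List A) : Prop :=
  ∀ w' : List A, eval w' = eval w → w.length ≤ w'.length

lemma exists_isGeodesicWord (w : List A) :
    ∃ g : List A, IsGeodesicWord g ∧ eval g = eval w ∧ g.length ≤ w.length := by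
  classical
  have h : ∃ n, ∃ g : List A, eval g = eval w ∧ g.length = n := ⟨_, w, rfl, rfl⟩
  obtain ⟨g, hg, hn⟩ := Nat.find_spec h
  have key : ∀ g' : List A, eval g' = eval w → g.length ≤ g'.length := fun g' hg' =>
    hn ▸ Nat.find_min' h ⟨g', hg', rfl⟩
  exact ⟨g, fun w' hw' => key w' (hw'.trans hg), hg, key w rfl⟩

lemma isGeodesicWord_nil : IsGeodesicWord ([] : List A) := fun _ _ => Nat.zero_le _

lemma IsGeodesicWord.of_append {x y z : List A} (h : IsGeodesicWord (x ++ y ++ z)) :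
    IsGeodesicWord y := by
  intro w hw
  have := h (x ++ w ++ z) (by simp [hw])
  simp only [List.length_append] at this
  omega

lemma IsGeodesicWord.take {w : List A} (h : IsGeodesicWord w) (i : ℕ) :
    IsGeodesicWord (w.take i) :=
  IsGeodesicWord.of_append (x := []) (z := w.drop i) (by simpa using h)

lemma IsGeodesicWord.drop {w : List A} (h : IsGeodesicWord w) (i : ℕ) :
    IsGeodesicWord (w.drop i) :=
  IsGeodesicWord.of_append (x := w.take i) (z := []) (by simpa using h)

lemma IsGeodesicWord.injOn_eval_take {w : List A} (h : IsGeodesicWord w) :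
    Set.InjOn (fun i => eval (w.take i)) {i | i ≤ w.length} := by
  intro i hi j hj hij
  have h₁ := h.take i (w.take j) hij.symm
  have h₂ := h.take j (w.take i) hij
  simp only [Set.mem_ofPred_eq] at hi hj
  simp only [List.length_take] at h₁ h₂
  omega

/-- The path in the Cayley graph that starts at `x` and is labelled by the word `w`. -/
def wordPath (x : M) (w : List A) : DiPath (cayleyGraph A) where
  length := w.length
  vert i := x * eval (w.take i)
  adj i := ⟨w[i], (w[i]).2, by
    rw [mul_assoc, ← eval_singleton, ← eval_append]
    simp⟩

lemma wordPath_source (x : M) (w : List A) : (wordPath x w).source = x := by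
  simp [wordPath, DiPath.source]

lemma wordPath_target (x : M) (w : List A) : (wordPath x w).target = x * eval w := by
  simp [wordPath, DiPath.target]

lemma wordPath_support (x : M) (w : List A) :
    (wordPath x w).support = {y | ∃ i ≤ w.length, x * eval (w.take i) = y} := by
  ext y
  constructor
  · rintro ⟨i, rfl⟩
    exact ⟨i, Nat.lt_succ_iff.1 i.2, rfl⟩
  · rintro ⟨i, hi, rfl⟩
    exact ⟨⟨i, Nat.lt_succ_iff.2 hi⟩, rfl⟩

lemma DiPath.exists_word (p : DiPath (cayleyGraph A)) :
    ∃ w : List A, w.length = p.length ∧ p.source * eval w = p.target := by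
  have key : ∀ i (hi : i < p.length + 1),
      ∃ w : List A, w.length = i ∧ p.source * eval w = p.vert ⟨i, hi⟩ := by
    intro i
    induction i with
    | zero => exact fun _ => ⟨[], rfl, by simp [DiPath.source]⟩
    | succ i ih =>
      intro hi
      obtain ⟨w, hw, he⟩ := ih (by omega)
      obtain ⟨a, ha, hadj⟩ := p.adj ⟨i, by omega⟩
      refine ⟨w ++ [⟨a, ha⟩], by simp [hw], ?_⟩
      rw [eval_append, ← mul_assoc, he, eval_singleton]
      exact hadj
  exact key p.length (Nat.lt_succ_self _)

lemma dist_le_iff {n : ℕ} {x y : M} : dist (cayleyGraph A) x y ≤ n ↔ Near A n x y := by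
  constructor
  · intro h
    have h' : dist (cayleyGraph A) x y < ((n + 1 : ℕ) : ℕ∞) :=
      lt_of_le_of_lt h (by exact_mod_cast Nat.lt_succ_self n)
    obtain ⟨⟨p, hs, ht⟩, hp⟩ := iInf_lt_iff.1 h'
    obtain ⟨w, hw, he⟩ := p.exists_word
    refine ⟨w, ?_, by rw [← hs, he, ht]⟩
    have : p.length < n + 1 := by exact_mod_cast hp
    omega
  · rintro ⟨z, hz, rfl⟩
    exact (iInf_le _ ⟨wordPath x z, wordPath_source x z, wordPath_target x z⟩).trans
      (by exact_mod_cast hz)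

lemma near_of_dist_le {δ : ℝ≥0} {D : ℕ} (hD : δ ≤ D) {x y : M}
    (h : (dist (cayleyGraph A) x y : ℝ≥0∞) ≤ δ) : Near A D x y := by
  refine dist_le_iff.1 ?_
  have h' : (dist (cayleyGraph A) x y : ℝ≥0∞) ≤ ((D : ℕ∞) : ℝ≥0∞) :=
    h.trans (by simpa using (ENNReal.coe_le_coe.2 hD))
  exact_mod_cast h'

lemma wordPath_isGeodesic [IsLeftCancelMul M] (x : M) {w : List A} (hw : IsGeodesicWord w) :
    (wordPath x w).IsGeodesic := by
  refine le_antisymm (le_iInf ?_) (dist_le_iff.2 ⟨w, le_rfl, ?_⟩)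
  · rintro ⟨p, hs, ht⟩
    obtain ⟨w', hw', he⟩ := p.exists_word
    rw [hs, ht, wordPath_source, wordPath_target] at he
    have := hw w' (mul_left_cancel he)
    rw [hw'] at this
    exact_mod_cast this
  · rw [wordPath_source, wordPath_target]

/-- The thin triangle condition in terms of words, with an integral bound. -/
structure ThinWords (D : ℕ) (p q r : List A) : Prop where
  hyp : ∀ i ≤ r.length, (∃ j ≤ p.length, Near A D (eval (p.take j)) (eval (r.take i))) ∨
    ∃ j ≤ q.length, Near A D (eval (r.take i)) (eval p * eval (q.take j))
  left : ∀ i ≤ p.length, (∃ j ≤ r.length, Near A D (eval (r.take j)) (eval (p.take i))) ∨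
    ∃ j ≤ q.length, Near A D (eval (p.take i)) (eval p * eval (q.take j))
  right : ∀ i ≤ q.length,
    (∃ j ≤ p.length, Near A D (eval (p.take j)) (eval p * eval (q.take i))) ∨
    ∃ j ≤ r.length, Near A D (eval p * eval (q.take i)) (eval (r.take j))

/-- All triangles of geodesic words are thin, with an integral bound. -/
def HyperbolicWords (A : Finset M) (D : ℕ) : Prop :=
  ∀ p q r : List A, IsGeodesicWord p → IsGeodesicWord q → IsGeodesicWord r →
    eval p * eval q = eval r → ThinWords D p q r

lemma StronglyDeltaHyperbolic.hyperbolicWords [IsLeftCancelMul M] {δ : ℝ≥0}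
    (h : StronglyDeltaHyperbolic (cayleyGraph A) δ) : ∃ D, HyperbolicWords A D := by
  obtain ⟨D, hD⟩ := exists_nat_ge δ
  refine ⟨D, fun p q r hp hq hr he => ?_⟩
  have ht := h (wordPath 1 p) (wordPath (eval p) q) (wordPath 1 r)
    ⟨wordPath_isGeodesic 1 hp, wordPath_isGeodesic _ hq, wordPath_isGeodesic 1 hr,
      by simp [wordPath_source, wordPath_target], by simp [wordPath_source],
      by simp [wordPath_target, he]⟩
  obtain ⟨h₁, h₂, h₃⟩ := ht
  simp only [wordPath_support, one_mul] at h₁ h₂ h₃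
  refine ⟨fun i hi => ?_, fun i hi => ?_, fun i hi => ?_⟩
  · rcases h₁ ⟨i, hi, rfl⟩ with ⟨_, ⟨j, hj, rfl⟩, hd⟩ | ⟨_, ⟨j, hj, rfl⟩, hd⟩
    exacts [.inl ⟨j, hj, near_of_dist_le hD hd⟩, .inr ⟨j, hj, near_of_dist_le hD hd⟩]
  · rcases h₂ ⟨i, hi, rfl⟩ with ⟨_, ⟨j, hj, rfl⟩, hd⟩ | ⟨_, ⟨j, hj, rfl⟩, hd⟩
    exacts [.inl ⟨j, hj, near_of_dist_le hD hd⟩, .inr ⟨j, hj, near_of_dist_le hD hd⟩]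
  · rcases h₃ ⟨i, hi, rfl⟩ with ⟨_, ⟨j, hj, rfl⟩, hd⟩ | ⟨_, ⟨j, hj, rfl⟩, hd⟩
    exacts [.inl ⟨j, hj, near_of_dist_le hD hd⟩, .inr ⟨j, hj, near_of_dist_le hD hd⟩]

end Words

/-! ### Balls under bounded indegree -/

section Balls

variable {M : Type u} [Monoid M]

/-- The elements whose right translation has fibres of bounded size form a submonoid, so bounded
indegree passes from the generators to all elements. -/
lemma BoundedIndegree.exists_card_fibre_le (h : BoundedIndegree M) (m : M) :
    ∃ k : ℕ, ∀ y : M, ∃ F : Finset M, F.card ≤ k ∧ ∀ x, x * m = y → x ∈ F := by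
  classical
  obtain ⟨A, hA, k, hk⟩ := h
  have hm : m ∈ Submonoid.closure (A : Set M) := by
    rw [show Submonoid.closure (A : Set M) = ⊤ from hA]; trivial
  induction hm using Submonoid.closure_induction with
  | mem a ha =>
    refine ⟨k, fun y => ?_⟩
    have hle : {x : M | x * a = y}.encard ≤ k := by
      by_contra! hlt
      obtain ⟨t, hts, ht⟩ := Set.exists_subset_encard_eq (Order.add_one_le_of_lt hlt)
      have hfin : t.Finite := Set.finite_of_encard_eq_coe (k := k + 1) (by exact_mod_cast ht)
      have hcard : t.ncard = k + 1 := by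
        rw [Set.ncard_def, ht]; rfl
      have := hfin.to_subtype
      let e : Fin (k + 1) ≃ t := (Finite.equivFinOfCardEq hcard).symm
      exact hk a ha ⟨fun i => (e i : M), Subtype.val_injective.comp e.injective,
        fun i j => (hts (e i).2 : _ = y).trans (hts (e j).2 : _ = y).symm⟩
    have hfin : {x : M | x * a = y}.Finite := Set.finite_of_encard_le_coe hle
    refine ⟨hfin.toFinset, ?_, by simp⟩
    rw [← ENat.natCast_le_natCast, ← Set.encard_coe_eq_coe_finsetCard]
    simpa using hle
  | one => exact ⟨1, fun y => ⟨{y}, by simp⟩⟩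
  | mul a b _ _ iha ihb =>
    obtain ⟨ka, iha⟩ := iha
    obtain ⟨kb, ihb⟩ := ihb
    choose Fa ha hFa using iha
    choose Fb hb hFb using ihb
    refine ⟨kb * ka, fun y => ⟨(Fb y).biUnion Fa, ?_, fun x hx => ?_⟩⟩
    · exact (Finset.card_biUnion_le_card_mul _ _ ka fun z _ => ha z).trans
        (Nat.mul_le_mul_right _ (hb y))
    · exact Finset.mem_biUnion.2 ⟨x * a, hFb y _ (by rw [mul_assoc, hx]), hFa _ _ rfl⟩

/-- In-balls of a fixed radius are uniformly finite under bounded indegree. -/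
lemma BoundedIndegree.exists_card_inBall_le (h : BoundedIndegree M) (A : Finset M) (n : ℕ) :
    ∃ k : ℕ, ∀ y : M, ∃ F : Finset M, F.card ≤ k ∧ ∀ x, Near A n x y → x ∈ F := by
  classical
  choose k F hF hmem using h.exists_card_fibre_le
  have hW := List.finite_length_le A n
  refine ⟨∑ z ∈ hW.toFinset, k (eval z), fun y =>
    ⟨hW.toFinset.biUnion fun z => F (eval z) y, ?_, ?_⟩⟩
  · exact Finset.card_biUnion_le.trans (Finset.sum_le_sum fun z _ => hF _ _)
  · rintro x ⟨z, hz, he⟩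
    exact Finset.mem_biUnion.2 ⟨z, by simpa using hz, hmem _ _ _ he⟩

lemma exists_card_outBall_le (A : Finset M) (n : ℕ) :
    ∃ k : ℕ, ∀ x : M, ∃ F : Finset M, F.card ≤ k ∧ ∀ y, Near A n x y → y ∈ F := by
  classical
  have hW := List.finite_length_le A n
  refine ⟨hW.toFinset.card, fun x => ⟨hW.toFinset.image fun z => x * eval z,
    Finset.card_image_le, ?_⟩⟩
  rintro y ⟨z, hz, rfl⟩
  exact Finset.mem_image.2 ⟨z, by simpa using hz, rfl⟩

/-- For words `z`, `z'` of bounded length, the solutions `p` of `p z = z'` are finitely many, so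
the geodesic words representing them have bounded length. -/
lemma BoundedIndegree.exists_geodesic_length_le (h : BoundedIndegree M) (A : Finset M) (n : ℕ) :
    ∃ k : ℕ, ∀ p z z' : List A, IsGeodesicWord p → z.length ≤ n → z'.length ≤ n →
      eval p * eval z = eval z' → p.length ≤ k := by
  classical
  choose c F hF hmem using h.exists_card_fibre_le
  have hW := List.finite_length_le A n
  set S : Finset M := hW.toFinset.biUnion fun z => hW.toFinset.biUnion fun z' =>
    F (eval z) (eval z')
  have hb : ∀ m : M, ∃ k, ∀ p : List A, IsGeodesicWord p → eval p = m → p.length ≤ k := by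
    intro m
    by_cases hm : ∃ w : List A, eval w = m
    · obtain ⟨w, rfl⟩ := hm
      exact ⟨w.length, fun p hp he => hp w he.symm⟩
    · exact ⟨0, fun p _ he => (hm ⟨p, he⟩).elim⟩
  choose b hb using hb
  refine ⟨S.sup b, fun p z z' hp hz hz' he => (hb _ p hp rfl).trans (Finset.le_sup ?_)⟩
  exact Finset.mem_biUnion.2 ⟨z, by simpa using hz,
    Finset.mem_biUnion.2 ⟨z', by simpa using hz', hmem _ _ _ he⟩⟩

end Balls

/-! ### The Dehn function -/

section Rewriting

variable {M : Type u} [Monoid M] {A : Finset M}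

/-- One application, inside a word, of a relation of `M` between words of length at most `K`. -/
def RStep (K : ℕ) (X Y : List A) : Prop :=
  ∃ c l r d : List A, X = c ++ l ++ d ∧ Y = c ++ r ++ d ∧ l.length ≤ K ∧ r.length ≤ K ∧
    eval l = eval r

/-- `n` successive applications of relations between words of length at most `K`. -/
def Derives (K : ℕ) : ℕ → List A → List A → Prop
  | 0, X, Y => X = Y
  | n + 1, X, Y => ∃ Z, RStep K X Z ∧ Derives K n Z Y

variable {K m n : ℕ} {X Y Z : List A}

lemma RStep.symm (h : RStep K X Y) : RStep K Y X := by
  obtain ⟨c, l, r, d, rfl, rfl, hl, hr, he⟩ := h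
  exact ⟨c, r, l, d, rfl, rfl, hr, hl, he.symm⟩

lemma RStep.append_right (h : RStep K X Y) (w : List A) : RStep K (X ++ w) (Y ++ w) := by
  obtain ⟨c, l, r, d, rfl, rfl, hl, hr, he⟩ := h
  exact ⟨c, l, r, d ++ w, by simp, by simp, hl, hr, he⟩

lemma RStep.length_le (h : RStep K X Y) : Y.length ≤ X.length + K := by
  obtain ⟨c, l, r, d, rfl, rfl, hl, hr, he⟩ := h
  simp only [List.length_append]; omega

lemma RStep.derives (h : RStep K X Y) : Derives K 1 X Y := ⟨Y, h, rfl⟩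

lemma Derives.trans (h : Derives K m X Y) (h' : Derives K n Y Z) : Derives K (m + n) X Z := by
  induction m generalizing X with
  | zero => cases h; simpa using h'
  | succ m ih =>
    obtain ⟨W, hW, h⟩ := h
    rw [Nat.add_right_comm]
    exact ⟨W, hW, ih h⟩

lemma Derives.symm (h : Derives K n X Y) : Derives K n Y X := by
  induction n generalizing X with
  | zero => exact Eq.symm h
  | succ n ih =>
    obtain ⟨W, hW, h⟩ := h
    exact (ih h).trans hW.symm.derives

lemma Derives.append_right (h : Derives K n X Y) (w : List A) :
    Derives K n (X ++ w) (Y ++ w) := by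
  induction n generalizing X with
  | zero => exact congrArg (· ++ w) h
  | succ n ih =>
    obtain ⟨W, hW, h⟩ := h
    exact ⟨W ++ w, hW.append_right w, ih h⟩

lemma Derives.succ_bound (h : Derives K n X Y) : Derives (K + 1) n X Y := by
  induction n generalizing X with
  | zero => exact h
  | succ n ih =>
    obtain ⟨Z, ⟨c, l, r, d, hX, hZ, hl, hr, he⟩, h⟩ := h
    exact ⟨Z, ⟨c, l, r, d, hX, hZ, by omega, by omega, he⟩, ih h⟩

/-- Two words that run along a common geodesic word and leave it by bounded words represent the
same element only if they differ by a single bounded relation: by left cancellation the segment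
of the geodesic between the two points of departure is a geodesic between bounded words, hence
bounded. -/
lemma BoundedIndegree.exists_rStep [IsLeftCancelMul M] (h : BoundedIndegree M) (A : Finset M)
    (n : ℕ) : ∃ K, ∀ g z z' : List A, ∀ j j' : ℕ, IsGeodesicWord g → z.length ≤ n →
      z'.length ≤ n → eval (g.take j ++ z) = eval (g.take j' ++ z') →
        RStep K (g.take j ++ z) (g.take j' ++ z') := by
  obtain ⟨k, hk⟩ := h.exists_geodesic_length_le A n
  refine ⟨k + n, ?_⟩
  have key : ∀ g z z' : List A, ∀ j j' : ℕ, j ≤ j' → IsGeodesicWord g → z.length ≤ n →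
      z'.length ≤ n → eval (g.take j ++ z) = eval (g.take j' ++ z') →
        RStep (k + n) (g.take j ++ z) (g.take j' ++ z') := by
    intro g z z' j j' hj hg hz hz' he
    have hsplit : g.take j' = g.take j ++ (g.take j').drop j := by
      conv_lhs => rw [← List.take_append_drop j (g.take j'), List.take_take, min_eq_left hj]
    set y := (g.take j').drop j
    have hy : IsGeodesicWord y := (hg.take j').drop j
    rw [hsplit] at he ⊢
    simp only [eval_append, mul_assoc] at he
    have he' := mul_left_cancel he
    have hlen := hk y z' z hy hz' hz he'.symm
    refine ⟨g.take j, z, y ++ z', [], by simp, by simp, by omega, ?_, by simpa using he'⟩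
    rw [List.length_append]; omega
  intro g z z' j j' hg hz hz' he
  rcases le_total j j' with hj | hj
  · exact key g z z' j j' hj hg hz hz' he
  · exact (key g z' z j' j hj hg hz' hz he.symm).symm

/-- A point `h.take i` of a geodesic word from which the end can be reached by a bounded word is
close to the end. -/
lemma Near.length_le {D i : ℕ} {h : List A} {x : M} (hx : Near A D (eval (h.take i)) x)
    {q : List A} (hq : x * eval q = eval h) [IsLeftCancelMul M] (hh : IsGeodesicWord h) :
    h.length ≤ i + D + q.length := by
  obtain ⟨z, hz, rfl⟩ := hx
  have := hh (h.take i ++ z ++ q) (by simpa [mul_assoc] using hq)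
  simp only [List.length_append, List.length_take] at this
  omega

/-- A thin triangle with a side `q` of length at most one: every point of `h` is reached by a
bounded word from some point of `g`. -/
lemma exists_fellow [IsLeftCancelMul M] {D : ℕ} (hD : HyperbolicWords A D) {g q h : List A}
    (hg : IsGeodesicWord g) (hq : IsGeodesicWord q) (hh : IsGeodesicWord h) (hq1 : q.length ≤ 1)
    (he : eval g * eval q = eval h) (i : ℕ) (hi : i ≤ h.length) :
    ∃ (j : ℕ) (z : List A), z.length ≤ 2 * D + 2 ∧ eval (g.take j ++ z) = eval (h.take i) := by
  -- The points of `h` outside the last `D + 1` steps are within `D` of `g`.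
  have near : ∀ i', i' + (D + 1) < h.length →
      ∃ (j : ℕ) (z : List A), z.length ≤ D ∧ eval (g.take j ++ z) = eval (h.take i') := by
    intro i' hi'
    rcases (hD g q h hg hq hh he).hyp i' (by omega) with ⟨j, -, z, hz, hz'⟩ | ⟨j, -, hn⟩
    · exact ⟨j, z, hz, by simpa using hz'⟩
    · have := hn.length_le (q := q.drop j)
        (by rw [mul_assoc, ← eval_append, List.take_append_drop, he]) hh
      rw [List.length_drop] at this
      omega
  have base : ∃ (j : ℕ) (z : List A), z.length ≤ D ∧
      eval (g.take j ++ z) = eval (h.take (min i (h.length - (D + 2)))) := by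
    by_cases hl : D + 1 < h.length
    · exact near _ (by omega)
    · refine ⟨0, [], by simp, ?_⟩
      rw [show h.length - (D + 2) = 0 by omega]
      simp
  obtain ⟨j, z, hz, hz'⟩ := base
  set i' := min i (h.length - (D + 2))
  have hsplit : h.take i = h.take i' ++ (h.take i).drop i' := by
    conv_lhs =>
      rw [← List.take_append_drop i' (h.take i), List.take_take, min_eq_left (min_le_left _ _)]
  refine ⟨j, z ++ (h.take i).drop i', ?_, ?_⟩
  · simp only [List.length_append, List.length_drop, List.length_take]
    omega
  · rw [← List.append_assoc, eval_append, hz', ← eval_append, ← hsplit]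

/-- The third side of a thin triangle with a side of length at most one is derived along the
triangle, one bounded relation for each of its letters. -/
lemma exists_derives_triangle [IsLeftCancelMul M] (hdeg : BoundedIndegree M) {D : ℕ}
    (hD : HyperbolicWords A D) : ∃ K, ∀ g q h : List A, IsGeodesicWord g → IsGeodesicWord q →
      IsGeodesicWord h → q.length ≤ 1 → eval g * eval q = eval h →
        Derives K (h.length + 2) h (g ++ q) := by
  obtain ⟨K, hK⟩ := hdeg.exists_rStep A (2 * D + 3)
  refine ⟨K, fun g q h hg hq hh hq1 he => ?_⟩
  -- The claim for all `j`, `z` at once makes the choices for consecutive `i` independent.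
  have key : ∀ i ≤ h.length, ∀ (j : ℕ) (z : List A), z.length ≤ 2 * D + 2 →
      eval (g.take j ++ z) = eval (h.take i) → Derives K (i + 1) (h.take i) (g.take j ++ z) := by
    intro i
    induction i with
    | zero =>
      intro _ j z hz hjz
      have := hK g [] z 0 j hg (by simp) (by omega) (by simpa using hjz.symm)
      simpa using this.derives
    | succ i ih =>
      intro hi j z hz hjz
      obtain ⟨j₀, z₀, hz₀, hjz₀⟩ := exists_fellow hD hg hq hh hq1 he i (by omega)
      have hstep := (ih (by omega) j₀ z₀ hz₀ hjz₀).append_right [h[i]]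
      have htake : h.take i ++ [h[i]] = h.take (i + 1) := by simp
      rw [htake, List.append_assoc] at hstep
      refine hstep.trans (hK g (z₀ ++ [h[i]]) z j₀ j hg ?_ (by omega) ?_).derives
      · simp only [List.length_append, List.length_singleton]; omega
      · rw [hjz, ← List.append_assoc, eval_append, hjz₀, ← eval_append, htake]
  obtain ⟨j, z, hz, hjz⟩ := exists_fellow hD hg hq hh hq1 he h.length le_rfl
  have h₁ := key _ le_rfl j z hz hjz
  rw [List.take_length] at h₁ hjz
  refine h₁.trans (n := 1) ?_
  have := hK g z q j g.length hg (by omega) (by omega) (by rw [hjz, ← he]; simp)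
  simpa using this.derives

/-- Every word is reduced to a geodesic word in quadratically many steps, letter by letter. The
statement on triangles is repeated so that one bound `K` serves for both. -/
lemma exists_derives_geodesic [IsLeftCancelMul M] (hdeg : BoundedIndegree M) {D : ℕ}
    (hD : HyperbolicWords A D) : ∃ K, (∀ g q h : List A, IsGeodesicWord g → IsGeodesicWord q →
      IsGeodesicWord h → q.length ≤ 1 → eval g * eval q = eval h →
        Derives K (h.length + 2) h (g ++ q)) ∧ ∀ w : List A, ∃ g, IsGeodesicWord g ∧
      eval g = eval w ∧ ∃ n ≤ w.length * (w.length + 4), Derives K n w g := by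
  obtain ⟨K, hK⟩ := exists_derives_triangle hdeg hD
  -- The relation between a single letter and its geodesic word requires a bound of at least one.
  refine ⟨K + 1, fun g q h hg hq hh hq1 he => (hK g q h hg hq hh hq1 he).succ_bound,
    fun w => ?_⟩
  induction w using List.reverseRecOn with
  | nil => exact ⟨[], isGeodesicWord_nil, rfl, 0, by simp, rfl⟩
  | append_singleton w a ih =>
    obtain ⟨g, hg, he, n, hn, hd⟩ := ih
    have hd' := hd.append_right [a]
    obtain ⟨q, hq, hqe, hql⟩ := exists_isGeodesicWord [a]
    obtain ⟨h, hh, hhe, hhl⟩ := exists_isGeodesicWord (w ++ [a])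
    have hga : eval g * eval q = eval h := by rw [hhe, hqe, he, eval_append]
    rw [List.length_singleton] at hql
    have h₁ : Derives (K + 1) 1 (g ++ [a]) (g ++ q) := RStep.derives
      ⟨g, [a], q, [], by simp, by simp, by simp, by omega, hqe.symm⟩
    have h₂ := (Derives.succ_bound (hK g q h hg hq hh hql hga)).symm
    refine ⟨h, hh, hhe, _, ?_, (hd'.trans h₁).trans h₂⟩
    simp only [List.length_append, List.length_singleton] at hhl ⊢
    nlinarith

/-- A quadratic Dehn function: words representing the same element are joined by quadratically
many applications of bounded relations. -/
theorem exists_derives_of_eval_eq [IsLeftCancelMul M] (hdeg : BoundedIndegree M) {D : ℕ}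
    (hD : HyperbolicWords A D) : ∃ K, ∀ v w : List A, eval v = eval w →
      ∃ n ≤ v.length * (v.length + 4) + (v.length + 2) + w.length * (w.length + 4),
        Derives K n v w := by
  obtain ⟨K, hK, hred⟩ := exists_derives_geodesic hdeg hD
  refine ⟨K, fun v w he => ?_⟩
  obtain ⟨g, hg, hge, m, hm, hvg⟩ := hred v
  obtain ⟨h, hh, hhe, n, hn, hwh⟩ := hred w
  have hgh := hK h [] g hh isGeodesicWord_nil hg (by simp) (by simp [hge, hhe, he])
  rw [List.append_nil] at hgh
  have hgl := hg v hge.symm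
  exact ⟨_, by omega, (hvg.trans hgh).trans hwh.symm⟩

end Rewriting

/-! ### Counting points of paths -/

section Counting

/-- Counting the points of an injective path: each lies in a finite set `F` or carries a colour
that no other point carries. -/
lemma succ_le_card_add_card {α γ : Type*} {n : ℕ} {f : ℕ → α} (hf : Set.InjOn f {i | i ≤ n})
    (F : Finset α) (W : Finset γ) (P : ℕ → γ → Prop)
    (hP : ∀ i i' c, i < i' → i' ≤ n → P i c → P i' c → False)
    (h : ∀ i ≤ n, f i ∈ F ∨ ∃ c ∈ W, P i c) : n + 1 ≤ F.card + W.card := by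
  have h' : ∀ i, ∃ c : α ⊕ γ, i ≤ n → c ∈ F.disjSum W ∧ Sum.elim (fun x => f i = x) (P i) c := by
    intro i
    by_cases hi : i ≤ n
    · rcases h i hi with h₁ | ⟨c, hc, hPc⟩
      · exact ⟨.inl (f i), fun _ => ⟨by simpa using h₁, rfl⟩⟩
      · exact ⟨.inr c, fun _ => ⟨by simpa using hc, hPc⟩⟩
    · exact ⟨.inl (f i), fun hi' => (hi hi').elim⟩
  choose c hc using h'
  rw [← Finset.card_disjSum, ← Finset.card_range (n + 1)]
  refine Finset.card_le_card_of_injOn c (fun i hi => (hc i ?_).1) fun i hi j hj hij => ?_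
  · simpa [Nat.lt_succ_iff] using hi
  have hi : i ≤ n := by simpa [Nat.lt_succ_iff] using hi
  have hj : j ≤ n := by simpa [Nat.lt_succ_iff] using hj
  have h₁ := (hc i hi).2
  have h₂ := (hc j hj).2
  rw [← hij] at h₂
  cases hci : c i with
  | inl x =>
    rw [hci] at h₁ h₂
    exact hf hi hj (h₁.trans h₂.symm)
  | inr x =>
    rw [hci] at h₁ h₂
    rcases lt_trichotomy i j with hlt | heq | hlt
    · exact (hP i j x hlt hj h₁ h₂).elim
    · exact heq
    · exact (hP j i x hlt hi h₂ h₁).elim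

lemma exists_split {α : Type*} (t : List α) {k k' : ℕ} (h : k ≤ k') :
    ∃ t₁ t₂ t₃, t = t₁ ++ t₂ ++ t₃ ∧ t.take k = t₁ ∧ t.take k' = t₁ ++ t₂ := by
  have hsplit : t.take k' = t.take k ++ (t.take k').drop k := by
    conv_lhs => rw [← List.take_append_drop k (t.take k'), List.take_take, min_eq_left h]
  exact ⟨t.take k, (t.take k').drop k, t.drop k', by rw [← hsplit, List.take_append_drop], rfl,
    hsplit⟩

end Counting

/-! ### Length of minimal witnesses -/

section Witnesses

variable {M : Type u} [Monoid M] {A : Finset M}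

lemma Near.mono {m n : ℕ} (hmn : m ≤ n) {x y : M} (h : Near A m x y) : Near A n x y := by
  obtain ⟨z, hz, he⟩ := h
  exact ⟨z, hz.trans hmn, he⟩

lemma Near.trans {m n : ℕ} {x y z : M} (h : Near A m x y) (h' : Near A n y z) :
    Near A (m + n) x z := by
  obtain ⟨w, hw, rfl⟩ := h
  obtain ⟨w', hw', rfl⟩ := h'
  exact ⟨w ++ w', by rw [List.length_append]; omega, by simp [mul_assoc]⟩

/-- The words `s`, `t` over elements of `N` witness that `u` is obtained from `v` by multiplying
with elements of `N` on both sides. -/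
structure Witness (N : Submonoid M) (u v s t : List A) : Prop where
  left_mem : eval s ∈ N
  right_mem : eval t ∈ N
  eq : eval s * eval v * eval t = eval u

/-- A witness is minimal if its total length is least possible and, among the witnesses of that
total length, its left part is shortest. -/
structure MinimalWitness (N : Submonoid M) (u v s t : List A) : Prop extends
    Witness N u v s t where
  le : ∀ s' t', Witness N u v s' t' → s.length + t.length ≤ s'.length + t'.length
  left_le : ∀ s' t', Witness N u v s' t' → s'.length + t'.length ≤ s.length + t.length →
    s.length ≤ s'.length

variable {N : Submonoid M} {u v s t : List A}

lemma Witness.exists_minimal (h : Witness N u v s t) : ∃ s t, MinimalWitness N u v s t := by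
  classical
  have h₁ : ∃ n, ∃ s t, Witness N u v s t ∧ s.length + t.length = n := ⟨_, s, t, h, rfl⟩
  have h₂ : ∃ m, ∃ s t, Witness N u v s t ∧ s.length + t.length = Nat.find h₁ ∧ s.length = m := by
    obtain ⟨s, t, hw, hn⟩ := Nat.find_spec h₁
    exact ⟨_, s, t, hw, hn, rfl⟩
  obtain ⟨s, t, hw, hn, hm⟩ := Nat.find_spec h₂
  have hle : ∀ s' t', Witness N u v s' t' → s.length + t.length ≤ s'.length + t'.length :=
    fun s' t' h' => hn ▸ Nat.find_min' h₁ ⟨s', t', h', rfl⟩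
  exact ⟨s, t, hw, hle, fun s' t' h' hl =>
    hm ▸ Nat.find_min' h₂ ⟨s', t', h', (le_antisymm hl (hle s' t' h')).trans hn, rfl⟩⟩

lemma MinimalWitness.isGeodesicWord_left (h : MinimalWitness N u v s t) : IsGeodesicWord s := by
  intro w hw
  have := h.le w t ⟨hw ▸ h.left_mem, h.right_mem, by rw [hw, h.eq]⟩
  omega

lemma MinimalWitness.isGeodesicWord_right (h : MinimalWitness N u v s t) : IsGeodesicWord t := by
  intro w hw
  have := h.le s w ⟨h.left_mem, hw ▸ h.right_mem, by rw [hw, h.eq]⟩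
  omega

/-- In a minimal witness no two factors can be cut out simultaneously. -/
lemma MinimalWitness.not_cut (hN : ∀ x y, x * y ∈ N → x ∈ N ∧ y ∈ N) {s₁ s₂ s₃ t₁ t₂ t₃ : List A}
    (h : MinimalWitness N u v (s₁ ++ s₂ ++ s₃) (t₁ ++ t₂ ++ t₃)) (hs : s₂ ≠ [])
    (he : eval s₂ * eval s₃ * eval v * eval t₁ * eval t₂ = eval s₃ * eval v * eval t₁) :
    False := by
  have hl := h.left_mem
  have hr := h.right_mem
  have heq := h.eq
  simp only [eval_append] at hl hr heq
  have hs₁ := (hN _ _ (hN _ _ hl).1).1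
  have hs₃ := (hN _ _ hl).2
  have ht₁ := (hN _ _ (hN _ _ hr).1).1
  have ht₃ := (hN _ _ hr).2
  have hle := h.le (s₁ ++ s₃) (t₁ ++ t₃) ⟨by simpa using mul_mem hs₁ hs₃,
    by simpa using mul_mem ht₁ ht₃, by
      calc _ = eval s₁ * (eval s₃ * eval v * eval t₁) * eval t₃ := by
            simp only [eval_append, mul_assoc]
        _ = _ := by rw [← he, ← heq]; simp only [mul_assoc]⟩
  have := List.length_pos_of_ne_nil hs
  simp only [List.length_append] at hle
  omega

/-- In a minimal witness no factor of the left part can be traded for a factor of the right part: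
one of the two trades would not increase the total length, and the one that keeps it shortens the
left part. -/
lemma MinimalWitness.not_trade (hN : ∀ x y, x * y ∈ N → x ∈ N ∧ y ∈ N)
    {s₁ s₂ s₃ t₁ t₂ t₃ : List A}
    (h : MinimalWitness N u v (s₁ ++ s₂ ++ s₃) (t₁ ++ t₂ ++ t₃)) (hs : s₂ ≠ [])
    (he : eval s₂ * eval s₃ * eval v * eval t₁ = eval s₃ * eval v * eval t₁ * eval t₂) :
    False := by
  have hl := h.left_mem
  have hr := h.right_mem
  have heq := h.eq
  simp only [eval_append] at hl hr heq
  have hs₁ := (hN _ _ (hN _ _ hl).1).1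
  have hs₂ := (hN _ _ (hN _ _ hl).1).2
  have hs₃ := (hN _ _ hl).2
  have ht₁ := (hN _ _ (hN _ _ hr).1).1
  have ht₂ := (hN _ _ (hN _ _ hr).1).2
  have ht₃ := (hN _ _ hr).2
  have h₁ : Witness N u v (s₁ ++ s₂ ++ s₂ ++ s₃) (t₁ ++ t₃) :=
    ⟨by simpa [mul_assoc] using mul_mem (mul_mem hs₁ hs₂) (mul_mem hs₂ hs₃),
      by simpa using mul_mem ht₁ ht₃, by
      calc _ = eval s₁ * eval s₂ * (eval s₂ * eval s₃ * eval v * eval t₁) * eval t₃ := by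
            simp only [eval_append, mul_assoc]
        _ = _ := by rw [he, ← heq]; simp only [mul_assoc]⟩
  have h₂ : Witness N u v (s₁ ++ s₃) (t₁ ++ t₂ ++ t₂ ++ t₃) :=
    ⟨by simpa using mul_mem hs₁ hs₃,
      by simpa [mul_assoc] using mul_mem (mul_mem ht₁ ht₂) (mul_mem ht₂ ht₃), by
      calc _ = eval s₁ * (eval s₃ * eval v * eval t₁ * eval t₂) * eval t₂ * eval t₃ := by
            simp only [eval_append, mul_assoc]
        _ = _ := by rw [← he, ← heq]; simp only [mul_assoc]⟩
  have hle₁ := h.le _ _ h₁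
  have hle₂ := h.left_le _ _ h₂
  have := List.length_pos_of_ne_nil hs
  simp only [List.length_append] at hle₁ hle₂
  omega

/-- The pumping argument: if two points of the left part of a minimal witness and two points of
the right part are joined by the same pair of words `z`, `z'` issuing from a common point, then a
factor can be cut out or traded. -/
lemma MinimalWitness.not_pump [IsLeftCancelMul M] (hN : ∀ x y, x * y ∈ N → x ∈ N ∧ y ∈ N)
    (h : MinimalWitness N u v s t) {i i' : ℕ} (hi : i < i') (hi' : i' ≤ s.length) {k k' : ℕ}
    {x x' : M} {z z' : List A} (hx : x * eval z = eval (s.take i))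
    (hy : x * eval z' = eval s * eval v * eval (t.take k))
    (hx' : x' * eval z = eval (s.take i'))
    (hy' : x' * eval z' = eval s * eval v * eval (t.take k')) : False := by
  obtain ⟨s₁, s₂, s₃, hs, hs₁, hs₂⟩ := exists_split s hi.le
  have hne : s₂ ≠ [] := by
    rintro rfl
    have := congrArg List.length (hs₂.trans (List.append_nil _ |>.trans hs₁.symm))
    simp only [List.length_take] at this
    omega
  rw [hs₁] at hx
  rw [hs₂] at hx'
  subst hs
  have e : eval z * (eval s₂ * eval s₃ * eval v * eval (t.take k)) = eval z' := by
    refine mul_left_cancel (a := x) ?_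
    rw [hy, ← mul_assoc, hx]; simp only [eval_append, mul_assoc]
  have e' : eval z * (eval s₃ * eval v * eval (t.take k')) = eval z' := by
    refine mul_left_cancel (a := x') ?_
    rw [hy', ← mul_assoc, hx']; simp only [eval_append, mul_assoc]
  have key := mul_left_cancel (e.trans e'.symm)
  rcases le_total k' k with hk | hk
  · obtain ⟨t₁, t₂, t₃, ht, ht₁, ht₂⟩ := exists_split t hk
    rw [ht₁, ht₂] at key
    subst ht
    exact h.not_cut hN hne (by simpa [mul_assoc] using key)
  · obtain ⟨t₁, t₂, t₃, ht, ht₁, ht₂⟩ := exists_split t hk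
    rw [ht₁, ht₂] at key
    subst ht
    exact h.not_trade hN hne (by simpa [mul_assoc] using key)

/-- Minimal witnesses have linear length. The quadrilateral with sides `s`, `v`, `t`, `u` is cut
by a geodesic `w` into two thin triangles. A point of `s` lies near `v`, or near `u`, or near `t`
by way of a point of `w`; the points of the last kind are bounded in number by pumping. A point of
`t` lies near `w` or near `u`. -/
theorem exists_minimalWitness_length_le [IsLeftCancelMul M] (hdeg : BoundedIndegree M) {D : ℕ}
    (hD : HyperbolicWords A D) : ∃ C, ∀ N : Submonoid M, (∀ x y, x * y ∈ N → x ∈ N ∧ y ∈ N) →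
      ∀ u v s t : List A, MinimalWitness N u v s t →
        s.length ≤ C * (u.length + v.length + 1) ∧ t.length ≤ C * (u.length + v.length + 1) := by
  classical
  obtain ⟨a, ha⟩ := hdeg.exists_card_inBall_le A D
  obtain ⟨b, hb⟩ := exists_card_outBall_le A (D + D)
  choose I hI hmemI using ha
  choose O hO hmemO using hb
  set W := (List.finite_length_le A D).toFinset
  set c := (W ×ˢ W).card
  refine ⟨(a + b + c) + (a + b + c + 1) * (a + b), fun N hN u v s t h => ?_⟩
  obtain ⟨v', hv', hve, hvl⟩ := exists_isGeodesicWord v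
  obtain ⟨u', hu', hue, hul⟩ := exists_isGeodesicWord u
  obtain ⟨w, hw, hwe, hwl⟩ := exists_isGeodesicWord (s ++ v)
  have hs := h.isGeodesicWord_left
  have ht := h.isGeodesicWord_right
  have T₁ := hD s v' w hs hv' hw (by rw [hve, hwe, eval_append])
  have T₂ := hD w t u' hw ht hu' (by rw [hue, hwe, eval_append, h.eq])
  have hunion : ∀ (B : M → Finset M) (b : ℕ), (∀ x, (B x).card ≤ b) → ∀ (f : ℕ → M) (n : ℕ),
      ((Finset.range (n + 1)).biUnion fun j => B (f j)).card ≤ (n + 1) * b := by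
    intro B b hB f n
    simpa using Finset.card_biUnion_le_card_mul (Finset.range (n + 1)) (fun j => B (f j)) b
      fun j _ => hB _
  have hsl : s.length + 1 ≤ (v'.length + 1) * a + (u'.length + 1) * b + c := by
    refine (succ_le_card_add_card hs.injOn_eval_take
      (((Finset.range (v'.length + 1)).biUnion fun j => I (eval s * eval (v'.take j))) ∪
        (Finset.range (u'.length + 1)).biUnion fun j => O (eval (u'.take j))) (W ×ˢ W)
      (fun i z => ∃ x k, x * eval z.1 = eval (s.take i) ∧
        x * eval z.2 = eval s * eval v * eval (t.take k)) ?_ ?_).trans ?_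
    · rintro i i' z hi hi' ⟨x, k, hx, hy⟩ ⟨x', k', hx', hy'⟩
      exact h.not_pump hN hi hi' hx hy hx' hy'
    · intro i hi
      simp only [Finset.mem_union, Finset.mem_biUnion, Finset.mem_range, Nat.lt_succ_iff]
      rcases T₁.left i hi with ⟨j, hj, hn⟩ | ⟨j, hj, hn⟩
      · rcases T₂.left j hj with ⟨k, hk, hn'⟩ | ⟨k, hk, hn'⟩
        · exact .inl (.inr ⟨k, hk, hmemO _ _ (hn'.trans hn)⟩)
        · obtain ⟨z, hz, hze⟩ := hn
          obtain ⟨z', hz', hze'⟩ := hn'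
          rw [hwe, eval_append] at hze'
          exact .inr ⟨(z, z'), by simp [W, hz, hz'], _, k, hze, hze'⟩
      · exact .inl (.inl ⟨j, hj, hmemI _ _ hn⟩)
    · gcongr
      exact (Finset.card_union_le _ _).trans (add_le_add (hunion I a hI _ _) (hunion O b hO _ _))
  have htl : t.length + 1 ≤ (w.length + 1) * b + (u'.length + 1) * a := by
    have hinj : Set.InjOn (fun i => eval w * eval (t.take i)) {i | i ≤ t.length} :=
      fun i hi j hj hij => ht.injOn_eval_take hi hj (mul_left_cancel hij)
    refine (succ_le_card_add_card hinj
      (((Finset.range (w.length + 1)).biUnion fun j => O (eval (w.take j))) ∪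
        (Finset.range (u'.length + 1)).biUnion fun j => I (eval (u'.take j)))
      (∅ : Finset Unit) (fun _ _ => False) (fun _ _ _ _ _ h _ => h) ?_).trans ?_
    · intro i hi
      simp only [Finset.mem_union, Finset.mem_biUnion, Finset.mem_range, Nat.lt_succ_iff]
      rcases T₂.right i hi with ⟨j, hj, hn⟩ | ⟨j, hj, hn⟩
      · exact .inl (.inl ⟨j, hj, hmemO _ _ (hn.mono (by omega))⟩)
      · exact .inl (.inr ⟨j, hj, hmemI _ _ hn⟩)
    · rw [Finset.card_empty, add_zero]
      exact (Finset.card_union_le _ _).trans (add_le_add (hunion O b hO _ _) (hunion I a hI _ _))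
  rw [List.length_append] at hwl
  set L := u.length + v.length + 1 with hL
  have hs' : s.length ≤ (a + b + c) * L := by
    have h₁ : (v'.length + 1) * a ≤ L * a := Nat.mul_le_mul_right _ (by omega)
    have h₂ : (u'.length + 1) * b ≤ L * b := Nat.mul_le_mul_right _ (by omega)
    have h₃ : 1 * c ≤ L * c := Nat.mul_le_mul_right _ (by omega)
    linarith
  have ht' : t.length ≤ ((a + b + c + 1) * (a + b)) * L := by
    have h₁ : (w.length + 1) * b ≤ ((a + b + c + 1) * L) * b := by
      gcongr; linarith
    have h₂ : (u'.length + 1) * a ≤ ((a + b + c + 1) * L) * a :=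
      Nat.mul_le_mul_right _ (by nlinarith)
    linarith
  constructor <;> nlinarith

end Witnesses

/-! ### Stack machines and their simulation by Turing machines -/

section StackMachines

/-- The instructions of a machine with stacks `0, …, k`: push a letter, pop a letter (possible only
if it is on top), and test for emptiness. -/
inductive Instr (k : ℕ) (Γ : Type u)
  | push (i : Fin (k + 1)) (x : Γ)
  | pop (i : Fin (k + 1)) (x : Γ)
  | empty (i : Fin (k + 1))

namespace Instr

variable {k : ℕ} {Γ : Type u}

instance [Finite Γ] : Finite (Instr k Γ) := by
  let f : Fin (k + 1) × Γ ⊕ Fin (k + 1) × Γ ⊕ Fin (k + 1) → Instr k Γ :=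
    Sum.elim (fun p => push p.1 p.2) (Sum.elim (fun p => pop p.1 p.2) empty)
  refine Finite.of_surjective f fun o => ?_
  cases o with
  | push i x => exact ⟨.inl (i, x), rfl⟩
  | pop i x => exact ⟨.inr (.inl (i, x)), rfl⟩
  | empty i => exact ⟨.inr (.inr i), rfl⟩

/-- The effect of an instruction on the stacks; the head of a list is the top of the stack. -/
def Apply : Instr k Γ → (Fin (k + 1) → List Γ) → (Fin (k + 1) → List Γ) → Prop
  | push i x, S, S' => S' = Function.update S i (x :: S i)
  | pop i x, S, S' => ∃ l, S i = x :: l ∧ S' = Function.update S i l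
  | empty i, S, S' => S i = [] ∧ S' = S

/-- The effect of a list of instructions on the stacks. -/
def Exec : List (Instr k Γ) → (Fin (k + 1) → List Γ) → (Fin (k + 1) → List Γ) → Prop
  | [], S, S' => S = S'
  | o :: l, S, S' => ∃ S₁, o.Apply S S₁ ∧ Exec l S₁ S'

end Instr

/-- A nondeterministic machine with finitely many stacks and states: a finite graph whose edges
are labelled by lists of instructions of bounded length. -/
structure StackMachine (α : Type u) where
  k : ℕ
  Γ : Type u
  [finiteΓ : Finite Γ]
  Q : Type
  [finiteQ : Finite Q]
  input : α ↪ Γ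
  start : Q
  accept : Q
  edges : Q → List (Instr k Γ) → Q → Prop
  bound : ℕ
  length_le : ∀ q l q', edges q l q' → l.length ≤ bound

namespace StackMachine

variable {α : Type u} (P : StackMachine α)

instance : Finite P.Γ := P.finiteΓ
instance : Finite P.Q := P.finiteQ

/-- A run along `n` edges. -/
def Run : ℕ → P.Q → (Fin (P.k + 1) → List P.Γ) → P.Q → (Fin (P.k + 1) → List P.Γ) → Prop
  | 0, q, S, q', S' => q = q' ∧ S = S'
  | n + 1, q, S, q', S' => ∃ l q₁ S₁, P.edges q l q₁ ∧ Instr.Exec l S S₁ ∧ Run n q₁ S₁ q' S'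

/-- At the start the input is on stack `0`, its first letter on top, and all other stacks are
empty. -/
def initStacks (w : List α) (i : Fin (P.k + 1)) : List P.Γ :=
  if i = 0 then w.map P.input else []

/-- Some run along exactly `n` edges leads from the start to the accepting state. -/
def AcceptsIn (w : List α) (n : ℕ) : Prop :=
  ∃ S, P.Run n P.start (P.initStacks w) P.accept S

/-- The control states of the simulating Turing machine: a letter that is about to be written on
some tape, the instructions that are still to be executed, and the state reached after them. -/
abbrev Control : Type u :=
  {σ : Option (Fin (P.k + 1) × P.Γ) × List (Instr P.k P.Γ) × P.Q // σ.2.1.length ≤ P.bound}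

instance : Finite P.Control := by
  have h := (List.finite_length_le (Instr P.k P.Γ) P.bound).to_subtype
  let f : P.Control → Option (Fin (P.k + 1) × P.Γ) ×
      {l : List (Instr P.k P.Γ) | l.length ≤ P.bound} × P.Q :=
    fun σ => (σ.1.1, ⟨σ.1.2.1, σ.2⟩, σ.1.2.2)
  refine Finite.of_injective f fun σ τ h => ?_
  obtain ⟨⟨a, l, q⟩, hσ⟩ := σ
  obtain ⟨⟨b, m, r⟩, hτ⟩ := τ
  simp only [f, Prod.mk.injEq, Subtype.mk.injEq] at h
  obtain ⟨rfl, rfl, rfl⟩ := h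
  rfl

/-- The letters of the tapes: `none` is the blank. -/
abbrev TapeLetter : Type := Option (Shrink.{0} P.Γ)

/-- The tape letter of a stack letter. -/
noncomputable def letter (x : P.Γ) : P.TapeLetter := some (equivShrink.{0} P.Γ x)

lemma letter_injective : Function.Injective P.letter :=
  (Option.some_injective _).comp (equivShrink.{0} P.Γ).injective

/-- The tape that represents a stack: the head scans the top of the stack, the rest extends to the
right. -/
noncomputable def tapeOf (l : List P.Γ) : Turing.Tape P.TapeLetter :=
  Turing.Tape.mk₁ (l.map P.letter)

variable {P} in
/-- The action that leaves the tapes with scanned letters `h` unchanged. -/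
def stay (h : Fin (P.k + 1) → P.TapeLetter) :
    Fin (P.k + 1) → P.TapeLetter × Option Turing.Dir :=
  fun i => (h i, none)

/-- The transitions of the simulating Turing machine. A push takes two transitions, since the head
has to move before it writes. -/
inductive Micro : Option (Fin (P.k + 1) × P.Γ) × List (Instr P.k P.Γ) × P.Q →
    (Fin (P.k + 1) → P.TapeLetter) →
    Option (Fin (P.k + 1) × P.Γ) × List (Instr P.k P.Γ) × P.Q →
    (Fin (P.k + 1) → P.TapeLetter × Option Turing.Dir) → Prop
  | edge {q l q'} (h) : P.edges q l q' → Micro (none, [], q) h (none, l, q') (stay h)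
  | pop {i x l q} (h) : h i = P.letter x → Micro (none, .pop i x :: l, q) h (none, l, q)
      (Function.update (stay h) i (none, some .right))
  | empty {i l q} (h) : h i = none → Micro (none, .empty i :: l, q) h (none, l, q) (stay h)
  | push {i x l q} (h) : Micro (none, .push i x :: l, q) h (some (i, x), l, q)
      (Function.update (stay h) i (h i, some .left))
  | fill {i x l q} (h) : Micro (some (i, x), l, q) h (none, l, q)
      (Function.update (stay h) i (P.letter x, none))

/-- The simulating Turing machine, with one tape for each stack. -/
noncomputable def toNTM : NTM α where
  numExtraTapes := P.k
  Γ := P.TapeLetter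
  Q := Shrink.{0} P.Control
  input := P.input.trans ⟨P.letter, P.letter_injective⟩
  input_ne_blank _ := Option.some_ne_none _
  start := equivShrink.{0} P.Control ⟨(none, [], P.start), Nat.zero_le _⟩
  accept := equivShrink.{0} P.Control ⟨(none, [], P.accept), Nat.zero_le _⟩
  next σ h := {τ | P.Micro ((equivShrink.{0} P.Control).symm σ).1 h
    ((equivShrink.{0} P.Control).symm τ.1).1 τ.2}

/-- The configuration of the Turing machine with given control state and tapes. -/
noncomputable def cfg (σ : P.Control) (T : Fin (P.k + 1) → Turing.Tape P.TapeLetter) :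
    P.toNTM.Cfg :=
  ⟨equivShrink.{0} P.Control σ, T⟩

/-- The configuration of the Turing machine that represents given stacks. -/
noncomputable def stackCfg (σ : P.Control) (S : Fin (P.k + 1) → List P.Γ) : P.toNTM.Cfg :=
  P.cfg σ fun i => P.tapeOf (S i)

variable {P}

lemma step_cfg_iff {σ : P.Control} {T : Fin (P.k + 1) → Turing.Tape P.TapeLetter}
    {c : P.toNTM.Cfg} : P.toNTM.Step (P.cfg σ T) c ↔
      ∃ (τ : P.Control) (a : Fin (P.k + 1) → P.TapeLetter × Option Turing.Dir),
        P.Micro σ.1 (fun i => (T i).head) τ.1 a ∧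
          c = P.cfg τ (fun i => NTM.act (N := P.toNTM) (T i) (a i)) := by
  constructor
  · rintro ⟨a, ha, ht⟩
    refine ⟨(equivShrink.{0} P.Control).symm c.state, a, ?_, ?_⟩
    · have : P.Micro ((equivShrink.{0} P.Control).symm (equivShrink.{0} P.Control σ)).1
        (fun i => (T i).head)
        ((equivShrink.{0} P.Control).symm c.state).1 a := ha
      rwa [Equiv.symm_apply_apply] at this
    · obtain ⟨q, T'⟩ := c
      have hT : T' = fun i => NTM.act (N := P.toNTM) (T i) (a i) := funext ht
      subst hT
      exact congrArg (fun q => NTM.Cfg.mk q _) (Equiv.apply_symm_apply _ q).symm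
  · rintro ⟨τ, a, h, rfl⟩
    refine ⟨a, ?_, fun i => rfl⟩
    change P.Micro ((equivShrink.{0} P.Control).symm (equivShrink.{0} P.Control σ)).1
        (fun i => (T i).head)
        ((equivShrink.{0} P.Control).symm (equivShrink.{0} P.Control τ)).1 a
    rwa [Equiv.symm_apply_apply, Equiv.symm_apply_apply]

lemma head_tapeOf_nil : (P.tapeOf []).head = none := rfl

lemma head_tapeOf_cons (x : P.Γ) (l : List P.Γ) : (P.tapeOf (x :: l)).head = P.letter x := rfl

lemma head_tapeOf_eq_none {l : List P.Γ} (h : (P.tapeOf l).head = none) : l = [] := by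
  cases l with
  | nil => rfl
  | cons x l => cases h

lemma head_tapeOf_eq_letter {l : List P.Γ} {x : P.Γ} (h : (P.tapeOf l).head = P.letter x) :
    ∃ l', l = x :: l' := by
  cases l with
  | nil => cases h
  | cons y l => exact ⟨l, by rw [P.letter_injective (h : P.letter y = _)]⟩

lemma act_stay (T : Turing.Tape P.TapeLetter) :
    NTM.act (N := P.toNTM) T (T.head, none) = T := rfl

/-- Popping erases the letter: the cells to the left of the head stay blank. -/
lemma act_pop (x : P.Γ) (l : List P.Γ) :
    NTM.act (N := P.toNTM) (P.tapeOf (x :: l)) (none, some .right) = P.tapeOf l := by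
  have h : (Turing.ListBlank.mk [] : Turing.ListBlank P.TapeLetter).cons none =
      Turing.ListBlank.mk [] := Turing.ListBlank.cons_head_tail (Turing.ListBlank.mk [])
  change Turing.Tape.mk (Turing.ListBlank.head _)
    ((Turing.ListBlank.mk [] : Turing.ListBlank P.TapeLetter).cons none) _ = _
  rw [h]
  rfl

lemma act_push (x : P.Γ) (l : List P.Γ) :
    NTM.act (N := P.toNTM) (NTM.act (N := P.toNTM) (P.tapeOf l) ((P.tapeOf l).head, some .left))
      (P.letter x, none) = P.tapeOf (x :: l) := by
  change Turing.Tape.mk (P.letter x) (Turing.ListBlank.mk [])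
    ((Turing.ListBlank.mk (l.map P.letter)).tail.cons (Turing.ListBlank.mk (l.map P.letter)).head)
    = _
  rw [Turing.ListBlank.cons_head_tail]
  rfl

lemma act_pop_stacks {S : Fin (P.k + 1) → List P.Γ} {i : Fin (P.k + 1)} {x : P.Γ} {l : List P.Γ}
    (h : S i = x :: l) :
    (fun j => NTM.act (N := P.toNTM) (P.tapeOf (S j))
      (Function.update (stay fun i => (P.tapeOf (S i)).head) i (none, some .right) j)) =
      fun j => P.tapeOf (Function.update S i l j) := by
  funext j
  by_cases hj : j = i
  · subst hj
    simp only [Function.update_self, h]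
    exact act_pop x l
  · simp only [Function.update_of_ne hj]
    exact act_stay _

lemma act_push_stacks (S : Fin (P.k + 1) → List P.Γ) (i : Fin (P.k + 1)) (x : P.Γ)
    {T : Fin (P.k + 1) → Turing.Tape P.TapeLetter}
    (hT : T = fun j => NTM.act (N := P.toNTM) (P.tapeOf (S j))
      (Function.update (stay fun i => (P.tapeOf (S i)).head) i
        ((P.tapeOf (S i)).head, some .left) j)) :
    (fun j => NTM.act (N := P.toNTM) (T j)
      (Function.update (stay fun i => (T i).head) i (P.letter x, none) j)) =
      fun j => P.tapeOf (Function.update S i (x :: S i) j) := by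
  funext j
  by_cases hj : j = i
  · subst hj
    rw [hT]
    simp only [Function.update_self]
    exact act_push x (S j)
  · simp only [Function.update_of_ne hj]
    refine (act_stay _).trans ?_
    rw [hT]
    simp only [Function.update_of_ne hj]
    exact act_stay _

lemma stepsTo_trans {N : NTM α} {m n : ℕ} {c₁ c₂ c₃ : N.Cfg} (h : N.StepsTo m c₁ c₂)
    (h' : N.StepsTo n c₂ c₃) : N.StepsTo (m + n) c₁ c₃ := by
  induction m generalizing c₁ with
  | zero => cases h; simpa using h'
  | succ m ih =>
    obtain ⟨c, hc, h⟩ := h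
    rw [Nat.add_right_comm]
    exact ⟨c, hc, ih h⟩

lemma exists_stepsTo_of_exec {l : List (Instr P.k P.Γ)} {S S' : Fin (P.k + 1) → List P.Γ}
    (h : Instr.Exec l S S') (q : P.Q) (hl : l.length ≤ P.bound) :
    ∃ n ≤ 2 * l.length, P.toNTM.StepsTo n (P.stackCfg ⟨(none, l, q), hl⟩ S)
      (P.stackCfg ⟨(none, [], q), Nat.zero_le _⟩ S') := by
  induction l generalizing S with
  | nil => exact ⟨0, Nat.zero_le _, by cases h; rfl⟩
  | cons o l ih =>
    obtain ⟨S₁, ho, h⟩ := h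
    have hl' : l.length ≤ P.bound := (Nat.le_succ _).trans hl
    obtain ⟨n, hn, hsteps⟩ := ih h hl'
    rw [List.length_cons]
    cases o with
    | push i x =>
      refine ⟨n + 2, by omega, _, step_cfg_iff.2 ⟨⟨(some (i, x), l, q), hl'⟩, _, .push _, rfl⟩,
        _, step_cfg_iff.2 ⟨⟨(none, l, q), hl'⟩, _, .fill _, rfl⟩, ?_⟩
      rw [act_push_stacks S i x rfl, ← show S₁ = _ from ho]
      exact hsteps
    | pop i x =>
      obtain ⟨r, hr, rfl⟩ := ho
      refine ⟨n + 1, by omega, _, step_cfg_iff.2 ⟨⟨(none, l, q), hl'⟩, _, .pop _ ?_, rfl⟩, ?_⟩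
      · simp only [hr, head_tapeOf_cons]
      · rw [act_pop_stacks hr]
        exact hsteps
    | empty i =>
      obtain ⟨hi, rfl⟩ := ho
      refine ⟨n + 1, by omega, _, step_cfg_iff.2 ⟨⟨(none, l, q), hl'⟩, _, .empty _ ?_, rfl⟩, ?_⟩
      · simp only [hi, head_tapeOf_nil]
      · exact hsteps

lemma exists_stepsTo_of_run {m : ℕ} {q q' : P.Q} {S S' : Fin (P.k + 1) → List P.Γ}
    (h : P.Run m q S q' S') :
    ∃ n ≤ (2 * P.bound + 1) * m, P.toNTM.StepsTo n (P.stackCfg ⟨(none, [], q), Nat.zero_le _⟩ S)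
      (P.stackCfg ⟨(none, [], q'), Nat.zero_le _⟩ S') := by
  induction m generalizing q S with
  | zero =>
    obtain ⟨rfl, rfl⟩ := h
    exact ⟨0, Nat.zero_le _, rfl⟩
  | succ m ih =>
    obtain ⟨l, q₁, S₁, he, hx, h⟩ := h
    have hl := P.length_le _ _ _ he
    obtain ⟨n, hn, hsteps⟩ := ih h
    obtain ⟨n', hn', hsteps'⟩ := exists_stepsTo_of_exec hx q₁ hl
    refine ⟨(n' + n) + 1, ?_, _, step_cfg_iff.2 ⟨⟨(none, l, q₁), hl⟩, _, .edge _ he, rfl⟩,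
      stepsTo_trans hsteps' hsteps⟩
    nlinarith

/-- A computation of the Turing machine that ends in the accepting state executes the pending
instructions and then simulates a run. -/
lemma exists_run_of_stepsTo (n : ℕ) : ∀ (l : List (Instr P.k P.Γ)) (q : P.Q)
    (hl : l.length ≤ P.bound) (S : Fin (P.k + 1) → List P.Γ) (c : P.toNTM.Cfg),
    P.toNTM.StepsTo n (P.stackCfg ⟨(none, l, q), hl⟩ S) c → c.state = P.toNTM.accept →
      ∃ S₁ m S', Instr.Exec l S S₁ ∧ P.Run m q S₁ P.accept S' := by
  have acc : ∀ (σ : P.Control) T, (P.cfg σ T).state = P.toNTM.accept →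
      σ.1 = (none, [], P.accept) := by
    intro σ T h
    have := (equivShrink.{0} P.Control).injective h
    rw [this]
  induction n using Nat.strong_induction_on with
  | _ n ih =>
    intro l q hl S c hsteps hc
    match n, hsteps with
    | 0, hsteps =>
      cases hsteps
      have := acc _ _ hc
      simp only [Prod.mk.injEq, true_and] at this
      obtain ⟨rfl, rfl⟩ := this
      exact ⟨S, 0, S, rfl, rfl, rfl⟩
    | n + 1, ⟨c₁, hstep, hsteps⟩ =>
      obtain ⟨⟨τ, hτ⟩, a, hm, rfl⟩ := step_cfg_iff.1 hstep
      cases hm with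
      | edge _ he =>
        obtain ⟨S₁, m, S', hx, hr⟩ := ih n (Nat.lt_succ_self n) _ _ hτ S c hsteps hc
        exact ⟨S, m + 1, S', rfl, _, _, _, he, hx, hr⟩
      | @pop i x l _ _ hx =>
        obtain ⟨r, hr⟩ := head_tapeOf_eq_letter hx
        rw [act_pop_stacks hr] at hsteps
        obtain ⟨S₁, m, S', hx, hrun⟩ := ih n (Nat.lt_succ_self n) _ _ hτ _ c hsteps hc
        exact ⟨S₁, m, S', ⟨_, ⟨r, hr, rfl⟩, hx⟩, hrun⟩
      | @empty i l _ _ hi =>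
        obtain ⟨S₁, m, S', hx, hrun⟩ := ih n (Nat.lt_succ_self n) _ _ hτ S c hsteps hc
        exact ⟨S₁, m, S', ⟨_, ⟨head_tapeOf_eq_none hi, rfl⟩, hx⟩, hrun⟩
      | @push i x l _ _ =>
        match n, hsteps with
        | 0, hsteps =>
          cases hsteps
          have := acc _ _ hc
          simp at this
        | n + 1, ⟨c₂, hstep₂, hsteps⟩ =>
          obtain ⟨⟨τ, hτ⟩, a, hm, rfl⟩ := step_cfg_iff.1 hstep₂
          cases hm
          rw [act_push_stacks S i x rfl] at hsteps
          obtain ⟨S₁, m, S', hx, hrun⟩ := ih n (by omega) _ _ hτ _ c hsteps hc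
          exact ⟨S₁, m, S', ⟨_, rfl, hx⟩, hrun⟩

lemma init_toNTM (w : List α) :
    P.toNTM.init w = P.stackCfg ⟨(none, [], P.start), Nat.zero_le _⟩ (P.initStacks w) := by
  refine congrArg (NTM.Cfg.mk _) (funext fun i => ?_)
  by_cases hi : i = 0
  · subst hi
    have : P.initStacks w 0 = w.map P.input := if_pos rfl
    refine (if_pos rfl).trans ?_
    change _ = P.tapeOf (P.initStacks w 0)
    rw [this, tapeOf, List.map_map]
    rfl
  · have : P.initStacks w i = [] := if_neg hi
    refine (if_neg hi).trans ?_
    change _ = P.tapeOf (P.initStacks w i)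
    rw [this]
    rfl

/-- Nondeterministic stack machines with polynomially long accepting runs accept languages
in NP. -/
theorem inNP (P : StackMachine α) (L : Language α) (f : Polynomial ℕ)
    (h : ∀ w, w ∈ L → ∃ n ≤ f.eval w.length, P.AcceptsIn w n)
    (h' : ∀ w n, P.AcceptsIn w n → w ∈ L) : InNP L := by
  refine ⟨P.toNTM, Polynomial.C (2 * P.bound + 1) * f, fun w => ⟨fun hw => ?_, fun n hn => ?_⟩⟩
  · obtain ⟨m, hm, S, hS⟩ := h w hw
    obtain ⟨n, hn, hsteps⟩ := exists_stepsTo_of_run hS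
    refine ⟨n, hn.trans ?_, _, (init_toNTM w).symm ▸ hsteps, rfl⟩
    rw [Polynomial.eval_C_mul]
    exact Nat.mul_le_mul_left _ hm
  · obtain ⟨c, hsteps, hc⟩ := hn
    rw [init_toNTM] at hsteps
    obtain ⟨S₁, m, S', hx, hrun⟩ := exists_run_of_stepsTo n _ _ _ _ _ hsteps hc
    cases hx
    exact h' w m ⟨S', hrun⟩

end StackMachine

end StackMachines

/-! ### Instructions on three stacks -/

section ThreeStacks

variable {M : Type u} {A B : Finset M}

/-- The stack letters: the input letters and the letters of the hyperbolic generating set. -/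
abbrev StackLetter (A B : Finset M) : Type u := Option A ⊕ B

/-- The instructions that push the letters of a word one after the other. -/
def pushWord (i : Fin 3) (w : List B) : List (Instr 2 (StackLetter A B)) :=
  w.map fun b => .push i (.inr b)

/-- The instructions that pop the letters of a word one after the other. -/
def popWord (i : Fin 3) (w : List B) : List (Instr 2 (StackLetter A B)) :=
  w.map fun b => .pop i (.inr b)

/-- Three stacks with contents `R`, `L` and `U`. -/
def threeStacks {Γ : Type u} (R L U : List Γ) : Fin 3 → List Γ := ![R, L, U]

/-- A word over `B` as a stack with the last letter on top. -/
def ontoStack (A : Finset M) (w : List B) : List (StackLetter A B) := w.reverse.map .inr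

section

variable {Γ : Type u} {R L U X : List Γ} {S' : Fin 3 → List Γ} {x : Γ} {l : List (Instr 2 Γ)}

lemma update_stacks_zero : Function.update (threeStacks R L U) 0 X = threeStacks X L U := by
  funext i; fin_cases i <;> rfl

lemma update_stacks_one : Function.update (threeStacks R L U) 1 X = threeStacks R X U := by
  funext i; fin_cases i <;> rfl

lemma update_stacks_two : Function.update (threeStacks R L U) 2 X = threeStacks R L X := by
  funext i; fin_cases i <;> rfl

lemma exec_nil {S : Fin 3 → List Γ} : Instr.Exec (k := 2) [] S S' ↔ S' = S := eq_comm

lemma exec_pop_zero : Instr.Exec (.pop 0 x :: l) (threeStacks R L U) S' ↔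
    ∃ R', R = x :: R' ∧ Instr.Exec l (threeStacks R' L U) S' := by
  constructor
  · rintro ⟨_, ⟨R', hR, rfl⟩, h⟩
    exact ⟨R', hR, by rwa [update_stacks_zero] at h⟩
  · rintro ⟨R', hR, h⟩
    exact ⟨_, ⟨R', hR, update_stacks_zero.symm⟩, h⟩

lemma exec_pop_one : Instr.Exec (.pop 1 x :: l) (threeStacks R L U) S' ↔
    ∃ L', L = x :: L' ∧ Instr.Exec l (threeStacks R L' U) S' := by
  constructor
  · rintro ⟨_, ⟨R', hR, rfl⟩, h⟩
    exact ⟨R', hR, by rwa [update_stacks_one] at h⟩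
  · rintro ⟨R', hR, h⟩
    exact ⟨_, ⟨R', hR, update_stacks_one.symm⟩, h⟩

lemma exec_pop_two : Instr.Exec (.pop 2 x :: l) (threeStacks R L U) S' ↔
    ∃ U', U = x :: U' ∧ Instr.Exec l (threeStacks R L U') S' := by
  constructor
  · rintro ⟨_, ⟨R', hR, rfl⟩, h⟩
    exact ⟨R', hR, by rwa [update_stacks_two] at h⟩
  · rintro ⟨R', hR, h⟩
    exact ⟨_, ⟨R', hR, update_stacks_two.symm⟩, h⟩

lemma exec_push_zero : Instr.Exec (.push 0 x :: l) (threeStacks R L U) S' ↔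
    Instr.Exec l (threeStacks (x :: R) L U) S' := by
  constructor
  · rintro ⟨_, rfl, h⟩
    rwa [update_stacks_zero] at h
  · exact fun h => ⟨_, update_stacks_zero.symm, h⟩

lemma exec_push_one : Instr.Exec (.push 1 x :: l) (threeStacks R L U) S' ↔
    Instr.Exec l (threeStacks R (x :: L) U) S' := by
  constructor
  · rintro ⟨_, rfl, h⟩
    rwa [update_stacks_one] at h
  · exact fun h => ⟨_, update_stacks_one.symm, h⟩

lemma exec_push_two : Instr.Exec (.push 2 x :: l) (threeStacks R L U) S' ↔
    Instr.Exec l (threeStacks R L (x :: U)) S' := by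
  constructor
  · rintro ⟨_, rfl, h⟩
    rwa [update_stacks_two] at h
  · exact fun h => ⟨_, update_stacks_two.symm, h⟩

lemma exec_empty_zero : Instr.Exec (.empty 0 :: l) (threeStacks R L U) S' ↔
    R = [] ∧ Instr.Exec l (threeStacks R L U) S' :=
  ⟨fun ⟨_, ⟨hR, hS⟩, h⟩ => ⟨hR, hS ▸ h⟩, fun ⟨hR, h⟩ => ⟨_, ⟨hR, rfl⟩, h⟩⟩

lemma exec_empty_one : Instr.Exec (.empty 1 :: l) (threeStacks R L U) S' ↔
    L = [] ∧ Instr.Exec l (threeStacks R L U) S' :=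
  ⟨fun ⟨_, ⟨hR, hS⟩, h⟩ => ⟨hR, hS ▸ h⟩, fun ⟨hR, h⟩ => ⟨_, ⟨hR, rfl⟩, h⟩⟩

lemma exec_empty_two : Instr.Exec (.empty 2 :: l) (threeStacks R L U) S' ↔
    U = [] ∧ Instr.Exec l (threeStacks R L U) S' :=
  ⟨fun ⟨_, ⟨hR, hS⟩, h⟩ => ⟨hR, hS ▸ h⟩, fun ⟨hR, h⟩ => ⟨_, ⟨hR, rfl⟩, h⟩⟩

end

variable {R L U : List (StackLetter A B)} {S' : Fin 3 → List (StackLetter A B)}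
  {l : List (Instr 2 (StackLetter A B))}

lemma ontoStack_append (w w' : List B) :
    ontoStack A (w ++ w') = ontoStack A w' ++ ontoStack A w := by
  simp [ontoStack]

lemma ontoStack_concat (w : List B) (b : B) :
    ontoStack A (w ++ [b]) = .inr b :: ontoStack A w := by
  simp [ontoStack]

lemma ontoStack_eq_cons {w : List B} {b : B} (h : ontoStack A w = .inr b :: L) :
    ∃ w', w = w' ++ [b] ∧ L = ontoStack A w' := by
  obtain rfl | ⟨w', b', rfl⟩ := w.eq_nil_or_concat'
  · cases h
  · rw [ontoStack_concat, List.cons.injEq, Sum.inr.injEq] at h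
    exact ⟨w', by rw [h.1], h.2.symm⟩

lemma ontoStack_eq_nil {w : List B} (h : ontoStack A w = []) : w = [] := by
  simpa [ontoStack] using h

lemma map_eq_cons_inl {Y : List (Option A)} {x : Option A} {R : List (StackLetter A B)}
    (h : Y.map .inl = .inl x :: R) : ∃ Y', Y = x :: Y' ∧ R = Y'.map .inl := by
  obtain ⟨a, Y', rfl, ha, hR⟩ := List.map_eq_cons_iff.1 h
  exact ⟨Y', by rw [Sum.inl_injective ha], hR.symm⟩

lemma map_eq_cons_inr {Y : List B} {b : B} {R : List (StackLetter A B)}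
    (h : Y.map .inr = .inr b :: R) : ∃ Y', Y = b :: Y' ∧ R = Y'.map .inr := by
  obtain ⟨a, Y', rfl, ha, hR⟩ := List.map_eq_cons_iff.1 h
  exact ⟨Y', by rw [Sum.inr_injective ha], hR.symm⟩

lemma ontoStack_eq_append {X l : List B} {L : List (StackLetter A B)}
    (h : ontoStack A X = ontoStack A l ++ L) : ∃ X', X = X' ++ l ∧ L = ontoStack A X' := by
  induction l using List.reverseRecOn generalizing X with
  | nil => exact ⟨X, by simp, by simpa [ontoStack] using h.symm⟩
  | append_singleton l b ih =>
    rw [ontoStack_concat] at h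
    obtain ⟨X', rfl, h'⟩ := ontoStack_eq_cons h
    obtain ⟨X'', rfl, rfl⟩ := ih h'.symm
    exact ⟨X'', by simp, rfl⟩

lemma exec_pushWord_one (w : List B) : Instr.Exec (pushWord 1 w ++ l) (threeStacks R L U) S' ↔
    Instr.Exec l (threeStacks R (ontoStack A w ++ L) U) S' := by
  induction w generalizing L with
  | nil => rfl
  | cons b w ih =>
    rw [← List.singleton_append, ontoStack_append, List.append_assoc]
    exact exec_push_one.trans ih

lemma exec_pushWord_two (w : List B) : Instr.Exec (pushWord 2 w ++ l) (threeStacks R L U) S' ↔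
    Instr.Exec l (threeStacks R L (ontoStack A w ++ U)) S' := by
  induction w generalizing U with
  | nil => rfl
  | cons b w ih =>
    rw [← List.singleton_append, ontoStack_append, List.append_assoc]
    exact exec_push_two.trans ih

lemma exec_popWord (w : List B) : Instr.Exec (popWord 1 w.reverse ++ l) (threeStacks R L U) S' ↔
    ∃ L', L = ontoStack A w ++ L' ∧ Instr.Exec l (threeStacks R L' U) S' := by
  induction w using List.reverseRecOn generalizing L with
  | nil => simp [popWord, ontoStack]
  | append_singleton w b ih =>
    have : popWord 1 (w ++ [b]).reverse ++ l =
        (.pop 1 (.inr b) :: (popWord 1 w.reverse ++ l) : List (Instr 2 (StackLetter A B))) := by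
      simp [popWord]
    rw [this, exec_pop_one, ontoStack_concat]
    constructor
    · rintro ⟨L₁, rfl, h⟩
      obtain ⟨L', rfl, h'⟩ := ih.1 h
      exact ⟨L', rfl, h'⟩
    · rintro ⟨L', rfl, h⟩
      exact ⟨_, rfl, ih.2 ⟨L', rfl, h⟩⟩

end ThreeStacks

/-! ### The machine that verifies a witness -/

section WitnessMachine

variable {M : Type u} [Monoid M] {A B : Finset M}

/-- The phases of the machine that guesses and verifies a witness. -/
inductive Phase
  | readLeft | guessLeft | readRight | guessRight | rewrite | compare | done

instance : Finite Phase := by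
  let f : Phase → Fin 7 := fun p => match p with
    | .readLeft => 0 | .guessLeft => 1 | .readRight => 2 | .guessRight => 3 | .rewrite => 4
    | .compare => 5 | .done => 6
  refine Finite.of_injective f fun p q h => ?_
  cases p <;> cases q <;> first | rfl | exact absurd h (by decide)

/-- The edges of the machine that, given `u#v`, guesses words `s`, `t` over the letters in `N`,
rewrites `svt` by relations between words of length at most `K`, and compares the result with
`u`, where `φ` translates the input letters. Stack `0` holds the unread input, later the part of
the rewritten word to the right of the current position; stack `1` holds the part to the left of
it; stack `2` holds `u`. Both words on stacks `1` and `2` have their last letter on top. -/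
inductive WitnessEdge (φ : A → List B) (N : Submonoid M) (K : ℕ) :
    Phase → List (Instr 2 (StackLetter A B)) → Phase → Prop
  | readLeft (a : A) : WitnessEdge φ N K .readLeft
      (.pop 0 (.inl (some a)) :: pushWord 2 (φ a)) .readLeft
  | separator : WitnessEdge φ N K .readLeft [.pop 0 (.inl none)] .guessLeft
  | guessLeft (b : B) (hb : (b : M) ∈ N) : WitnessEdge φ N K .guessLeft
      [.push 1 (.inr b)] .guessLeft
  | endLeft : WitnessEdge φ N K .guessLeft [] .readRight
  | readRight (a : A) : WitnessEdge φ N K .readRight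
      (.pop 0 (.inl (some a)) :: pushWord 1 (φ a)) .readRight
  | endInput : WitnessEdge φ N K .readRight [.empty 0] .guessRight
  | guessRight (b : B) (hb : (b : M) ∈ N) : WitnessEdge φ N K .guessRight
      [.push 1 (.inr b)] .guessRight
  | endRight : WitnessEdge φ N K .guessRight [] .rewrite
  | moveRight (b : B) : WitnessEdge φ N K .rewrite [.pop 0 (.inr b), .push 1 (.inr b)] .rewrite
  | moveLeft (b : B) : WitnessEdge φ N K .rewrite [.pop 1 (.inr b), .push 0 (.inr b)] .rewrite
  | relation (l r : List B) (hl : l.length ≤ K) (hr : r.length ≤ K) (h : eval l = eval r) :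
      WitnessEdge φ N K .rewrite (popWord 1 l.reverse ++ pushWord 1 r) .rewrite
  | endRewrite : WitnessEdge φ N K .rewrite [.empty 0] .compare
  | compare (b : B) : WitnessEdge φ N K .compare [.pop 1 (.inr b), .pop 2 (.inr b)] .compare
  | accept : WitnessEdge φ N K .compare [.empty 1, .empty 2] .done

lemma WitnessEdge.length_le {φ : A → List B} {N : Submonoid M} {K c : ℕ}
    (hc : ∀ a, (φ a).length ≤ c) {p l q} (h : WitnessEdge φ N K p l q) :
    l.length ≤ 2 * K + c + 2 := by
  cases h with
  | readLeft a => have := hc a; simp [pushWord]; omega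
  | readRight a => have := hc a; simp [pushWord]; omega
  | relation l r hl hr => simp [pushWord, popWord]; omega
  | _ => simp

/-- The stack machine with edges `WitnessEdge`. -/
def witnessMachine (φ : A → List B) (N : Submonoid M) (K c : ℕ) (hc : ∀ a, (φ a).length ≤ c) :
    StackMachine (Option A) where
  k := 2
  Γ := StackLetter A B
  Q := Phase
  input := Function.Embedding.inl
  start := .readLeft
  accept := .done
  edges := WitnessEdge φ N K
  bound := 2 * K + c + 2
  length_le _ _ _ h := h.length_le hc

end WitnessMachine

/-! ### Accepted words have witnesses -/

section Soundness

variable {M : Type u} [Monoid M] {A B : Finset M}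

/-- The configurations that the machine can reach on the input `w`. -/
def Invariant (φ : A → List B) (N : Submonoid M) (w : List (Option A)) :
    Phase → (Fin 3 → List (StackLetter A B)) → Prop
  | .readLeft, S => ∃ (u : List A) (rest : List (Option A)), w = u.map some ++ rest ∧
      S = threeStacks (rest.map .inl) [] (ontoStack A (u.flatMap φ))
  | .guessLeft, S => ∃ (u : List A) (rest : List (Option A)) (s : List B),
      w = u.map some ++ none :: rest ∧ eval s ∈ N ∧
      S = threeStacks (rest.map .inl) (ontoStack A s) (ontoStack A (u.flatMap φ))
  | .readRight, S => ∃ (u v : List A) (rest : List (Option A)) (s : List B),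
      w = u.map some ++ none :: (v.map some ++ rest) ∧ eval s ∈ N ∧
      S = threeStacks (rest.map .inl) (ontoStack A (s ++ v.flatMap φ))
        (ontoStack A (u.flatMap φ))
  | .guessRight, S => ∃ (u v : List A) (s t : List B), w = pairWord u v ∧ eval s ∈ N ∧ eval t ∈ N ∧
      S = threeStacks [] (ontoStack A (s ++ v.flatMap φ ++ t)) (ontoStack A (u.flatMap φ))
  | .rewrite, S => ∃ (u v : List A) (X Y : List B), w = pairWord u v ∧
      (∃ s ∈ N, ∃ t ∈ N, s * eval (v.flatMap φ) * t = eval X * eval Y) ∧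
      S = threeStacks (Y.map .inr) (ontoStack A X) (ontoStack A (u.flatMap φ))
  | .compare, S => ∃ (u v : List A) (X Y Z : List B), w = pairWord u v ∧
      (∃ s ∈ N, ∃ t ∈ N, s * eval (v.flatMap φ) * t = eval X * eval Z) ∧
      eval (u.flatMap φ) = eval Y * eval Z ∧
      S = threeStacks [] (ontoStack A X) (ontoStack A Y)
  | .done, _ => ∃ u v : List A, w = pairWord u v ∧
      ∃ s ∈ N, ∃ t ∈ N, s * eval (v.flatMap φ) * t = eval (u.flatMap φ)

/-- The invariant passes along every edge: a relation keeps the value of the word on stacks `1` and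
`0`, and the common suffix removed by the comparison is remembered as `Z`. -/
lemma Invariant.of_edge {φ : A → List B} {N : Submonoid M} {K : ℕ} {w : List (Option A)}
    {p q : Phase} {l : List (Instr 2 (StackLetter A B))} {S S' : Fin 3 → List (StackLetter A B)}
    (hS : Invariant φ N w p S) (he : WitnessEdge φ N K p l q) (hx : Instr.Exec l S S') :
    Invariant φ N w q S' := by
  cases he with
  | readLeft a =>
    obtain ⟨u, rest, rfl, rfl⟩ := hS
    obtain ⟨R, hR, hx⟩ := exec_pop_zero.1 hx
    obtain ⟨rest, rfl, rfl⟩ := map_eq_cons_inl hR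
    rw [← List.append_nil (pushWord 2 (φ a)), exec_pushWord_two, exec_nil] at hx
    exact ⟨u ++ [a], rest, by simp, by rw [hx, ← ontoStack_append]; simp⟩
  | separator =>
    obtain ⟨u, rest, rfl, rfl⟩ := hS
    obtain ⟨R, hR, hx⟩ := exec_pop_zero.1 hx
    obtain ⟨rest, rfl, rfl⟩ := map_eq_cons_inl hR
    exact ⟨u, rest, [], rfl, one_mem N, exec_nil.1 hx⟩
  | guessLeft b hb =>
    obtain ⟨u, rest, s, rfl, hs, rfl⟩ := hS
    refine ⟨u, rest, s ++ [b], rfl, ?_, ?_⟩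
    · rw [eval_append, eval_singleton]; exact mul_mem hs hb
    · rw [ontoStack_concat]; exact exec_nil.1 (exec_push_one.1 hx)
  | endLeft =>
    obtain ⟨u, rest, s, rfl, hs, rfl⟩ := hS
    exact ⟨u, [], rest, s, rfl, hs, by simpa using exec_nil.1 hx⟩
  | readRight a =>
    obtain ⟨u, v, rest, s, rfl, hs, rfl⟩ := hS
    obtain ⟨R, hR, hx⟩ := exec_pop_zero.1 hx
    obtain ⟨rest, rfl, rfl⟩ := map_eq_cons_inl hR
    rw [← List.append_nil (pushWord 1 (φ a)), exec_pushWord_one, exec_nil] at hx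
    exact ⟨u, v ++ [a], rest, s, by simp, hs, by rw [hx, ← ontoStack_append]; simp⟩
  | endInput =>
    obtain ⟨u, v, rest, s, rfl, hs, rfl⟩ := hS
    obtain ⟨hR, hx⟩ := exec_empty_zero.1 hx
    obtain rfl := List.map_eq_nil_iff.1 hR
    exact ⟨u, v, s, [], by simp [pairWord], hs, one_mem N, by simpa using exec_nil.1 hx⟩
  | guessRight b hb =>
    obtain ⟨u, v, s, t, rfl, hs, ht, rfl⟩ := hS
    refine ⟨u, v, s, t ++ [b], rfl, hs, ?_, ?_⟩
    · rw [eval_append, eval_singleton]; exact mul_mem ht hb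
    · rw [← List.append_assoc, ontoStack_concat]; exact exec_nil.1 (exec_push_one.1 hx)
  | endRight =>
    obtain ⟨u, v, s, t, rfl, hs, ht, rfl⟩ := hS
    exact ⟨u, v, s ++ v.flatMap φ ++ t, [], rfl, ⟨eval s, hs, eval t, ht, by simp [mul_assoc]⟩,
      exec_nil.1 hx⟩
  | moveRight b =>
    obtain ⟨u, v, X, Y, rfl, ⟨s, hs, t, ht, h⟩, rfl⟩ := hS
    obtain ⟨R, hR, hx⟩ := exec_pop_zero.1 hx
    obtain ⟨Y, rfl, rfl⟩ := map_eq_cons_inr hR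
    refine ⟨u, v, X ++ [b], Y, rfl, ⟨s, hs, t, ht, ?_⟩, ?_⟩
    · rw [h, ← eval_append, ← eval_append]; simp
    · rw [ontoStack_concat]; exact exec_nil.1 (exec_push_one.1 hx)
  | moveLeft b =>
    obtain ⟨u, v, X, Y, rfl, ⟨s, hs, t, ht, h⟩, rfl⟩ := hS
    obtain ⟨L, hL, hx⟩ := exec_pop_one.1 hx
    obtain ⟨X, rfl, rfl⟩ := ontoStack_eq_cons hL
    refine ⟨u, v, X, b :: Y, rfl, ⟨s, hs, t, ht, ?_⟩, ?_⟩
    · rw [h, ← eval_append, ← eval_append]; simp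
    · exact exec_nil.1 (exec_push_zero.1 hx)
  | relation l r hl hr hlr =>
    obtain ⟨u, v, X, Y, rfl, ⟨s, hs, t, ht, h⟩, rfl⟩ := hS
    obtain ⟨L, hL, hx⟩ := (exec_popWord l).1 hx
    obtain ⟨X, rfl, rfl⟩ := ontoStack_eq_append hL
    rw [← List.append_nil (pushWord 1 r), exec_pushWord_one, exec_nil, ← ontoStack_append] at hx
    exact ⟨u, v, X ++ r, Y, rfl, ⟨s, hs, t, ht, by rw [h, eval_append, eval_append, hlr]⟩, hx⟩
  | endRewrite =>
    obtain ⟨u, v, X, Y, rfl, h, rfl⟩ := hS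
    obtain ⟨hR, hx⟩ := exec_empty_zero.1 hx
    obtain rfl := List.map_eq_nil_iff.1 hR
    exact ⟨u, v, X, u.flatMap φ, [], rfl, h, by simp, exec_nil.1 hx⟩
  | compare b =>
    obtain ⟨u, v, X, Y, Z, rfl, ⟨s, hs, t, ht, h⟩, h', rfl⟩ := hS
    obtain ⟨L, hL, hx⟩ := exec_pop_one.1 hx
    obtain ⟨U, hU, hx⟩ := exec_pop_two.1 hx
    obtain ⟨X, rfl, rfl⟩ := ontoStack_eq_cons hL
    obtain ⟨Y, rfl, rfl⟩ := ontoStack_eq_cons hU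
    refine ⟨u, v, X, Y, b :: Z, rfl, ⟨s, hs, t, ht, ?_⟩, ?_, exec_nil.1 hx⟩
    · rw [h, ← eval_append, ← eval_append]; simp
    · rw [h', ← eval_append, ← eval_append]; simp
  | accept =>
    obtain ⟨u, v, X, Y, Z, rfl, ⟨s, hs, t, ht, h⟩, h', rfl⟩ := hS
    obtain ⟨hL, hx⟩ := exec_empty_one.1 hx
    obtain ⟨hU, hx⟩ := exec_empty_two.1 hx
    obtain rfl := ontoStack_eq_nil hL
    obtain rfl := ontoStack_eq_nil hU
    exact ⟨u, v, rfl, s, hs, t, ht, by rw [h, h']⟩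

variable {φ : A → List B} {N : Submonoid M} {K c : ℕ} {hc : ∀ a, (φ a).length ≤ c}

lemma Invariant.of_run {w : List (Option A)} {n : ℕ} {p q : Phase}
    {S S' : Fin 3 → List (StackLetter A B)} (hS : Invariant φ N w p S)
    (h : (witnessMachine φ N K c hc).Run n p S q S') : Invariant φ N w q S' := by
  induction n generalizing p S with
  | zero =>
    obtain ⟨rfl, rfl⟩ := h
    exact hS
  | succ n ih =>
    obtain ⟨l, q₁, S₁, he, hx, h⟩ := h
    exact ih (hS.of_edge he hx) h

lemma initStacks_witnessMachine (w : List (Option A)) :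
    (witnessMachine φ N K c hc).initStacks w = threeStacks (w.map .inl) [] [] := by
  funext i
  change Fin 3 at i
  fin_cases i <;> rfl

lemma exists_witness_of_acceptsIn {w : List (Option A)} {n : ℕ}
    (h : (witnessMachine φ N K c hc).AcceptsIn w n) : ∃ u v : List A, w = pairWord u v ∧
      ∃ s ∈ N, ∃ t ∈ N, s * eval (v.flatMap φ) * t = eval (u.flatMap φ) := by
  obtain ⟨S, hS⟩ := h
  rw [initStacks_witnessMachine] at hS
  exact Invariant.of_run (p := .readLeft) (q := .done) ⟨[], w, by simp, rfl⟩ hS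

end Soundness

/-! ### Words with witnesses are accepted in polynomial time -/

section Completeness

variable {M : Type u} [Monoid M] {A B : Finset M} {φ : A → List B} {N : Submonoid M} {K c : ℕ}
  {hc : ∀ a, (φ a).length ≤ c}

lemma StackMachine.Run.trans {α : Type u} {P : StackMachine α} {m n : ℕ} {q₁ q₂ q₃ : P.Q}
    {S₁ S₂ S₃ : Fin (P.k + 1) → List P.Γ} (h : P.Run m q₁ S₁ q₂ S₂) (h' : P.Run n q₂ S₂ q₃ S₃) :
    P.Run (m + n) q₁ S₁ q₃ S₃ := by
  induction m generalizing q₁ S₁ with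
  | zero =>
    obtain ⟨rfl, rfl⟩ := h
    simpa using h'
  | succ m ih =>
    obtain ⟨l, q, S, he, hx, h⟩ := h
    rw [Nat.add_right_comm]
    exact ⟨l, q, S, he, hx, ih h⟩

variable (φ N K c hc) in
/-- Runs of the witness machine. -/
abbrev WRun (n : ℕ) (p : Phase) (S : Fin 3 → List (StackLetter A B)) (q : Phase)
    (S' : Fin 3 → List (StackLetter A B)) : Prop :=
  (witnessMachine φ N K c hc).Run n p S q S'

lemma WRun.of_edge {p q : Phase} {l : List (Instr 2 (StackLetter A B))}
    {S S' : Fin 3 → List (StackLetter A B)} (he : WitnessEdge φ N K p l q)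
    (hx : Instr.Exec l S S') : WRun φ N K c hc 1 p S q S' :=
  ⟨l, q, S', he, hx, rfl, rfl⟩

variable {R L U : List (StackLetter A B)}

lemma run_readLeft (u : List A) : WRun φ N K c hc u.length
    .readLeft (threeStacks ((u.map some).map .inl ++ R) L U)
    .readLeft (threeStacks R L (ontoStack A (u.flatMap φ) ++ U)) := by
  induction u generalizing U with
  | nil => exact ⟨rfl, rfl⟩
  | cons a u ih =>
    rw [List.length_cons, List.flatMap_cons, ontoStack_append, List.append_assoc]
    refine ⟨_, _, _, .readLeft a, exec_pop_zero.2 ⟨_, rfl, ?_⟩, ih⟩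
    rw [← List.append_nil (pushWord 2 (φ a))]
    exact (exec_pushWord_two _).2 rfl

lemma run_readRight (v : List A) : WRun φ N K c hc v.length
    .readRight (threeStacks ((v.map some).map .inl ++ R) L U)
    .readRight (threeStacks R (ontoStack A (v.flatMap φ) ++ L) U) := by
  induction v generalizing L with
  | nil => exact ⟨rfl, rfl⟩
  | cons a v ih =>
    rw [List.length_cons, List.flatMap_cons, ontoStack_append, List.append_assoc]
    refine ⟨_, _, _, .readRight a, exec_pop_zero.2 ⟨_, rfl, ?_⟩, ih⟩
    rw [← List.append_nil (pushWord 1 (φ a))]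
    exact (exec_pushWord_one _).2 rfl

lemma run_guessLeft (s : List B) (hs : ∀ b ∈ s, (b : M) ∈ N) : WRun φ N K c hc s.length
    .guessLeft (threeStacks R L U) .guessLeft (threeStacks R (ontoStack A s ++ L) U) := by
  induction s generalizing L with
  | nil => exact ⟨rfl, rfl⟩
  | cons b s ih =>
    rw [← List.singleton_append, ontoStack_append, List.append_assoc]
    exact ⟨_, _, _, .guessLeft b (hs b (by simp)), exec_push_one.2 rfl,
      ih fun b hb => hs b (by simp [hb])⟩

lemma run_guessRight (s : List B) (hs : ∀ b ∈ s, (b : M) ∈ N) : WRun φ N K c hc s.length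
    .guessRight (threeStacks R L U) .guessRight (threeStacks R (ontoStack A s ++ L) U) := by
  induction s generalizing L with
  | nil => exact ⟨rfl, rfl⟩
  | cons b s ih =>
    rw [← List.singleton_append, ontoStack_append, List.append_assoc]
    exact ⟨_, _, _, .guessRight b (hs b (by simp)), exec_push_one.2 rfl,
      ih fun b hb => hs b (by simp [hb])⟩

lemma run_moveLeft (d : List B) : WRun φ N K c hc d.length
    .rewrite (threeStacks R (ontoStack A d ++ L) U)
    .rewrite (threeStacks (d.map .inr ++ R) L U) := by
  induction d using List.reverseRecOn generalizing R with
  | nil => exact ⟨rfl, rfl⟩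
  | append_singleton d b ih =>
    rw [List.length_append, ontoStack_concat, List.map_append, List.append_assoc]
    exact ⟨_, _, _, .moveLeft b, exec_pop_one.2 ⟨_, rfl, exec_push_zero.2 rfl⟩, ih⟩

lemma run_moveRight (d : List B) : WRun φ N K c hc d.length
    .rewrite (threeStacks (d.map .inr ++ R) L U)
    .rewrite (threeStacks R (ontoStack A d ++ L) U) := by
  induction d generalizing L with
  | nil => exact ⟨rfl, rfl⟩
  | cons b d ih =>
    rw [← List.singleton_append, ontoStack_append, List.append_assoc]
    exact ⟨_, _, _, .moveRight b, exec_pop_zero.2 ⟨_, rfl, exec_push_one.2 rfl⟩, ih⟩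

/-- The word is kept on stack `1`; to apply a relation inside it, the part to the right is moved to
stack `0` and back. -/
lemma exists_run_of_rStep {X Y : List B} (h : RStep K X Y) : ∃ m ≤ 2 * X.length + 1,
    WRun φ N K c hc m .rewrite (threeStacks [] (ontoStack A X) U)
      .rewrite (threeStacks [] (ontoStack A Y) U) := by
  obtain ⟨p, l, r, d, rfl, rfl, hl, hr, he⟩ := h
  have hx : Instr.Exec (popWord 1 l.reverse ++ pushWord 1 r)
      (threeStacks (d.map .inr ++ []) (ontoStack A (p ++ l)) U)
      (threeStacks (d.map .inr ++ []) (ontoStack A (p ++ r)) U) := by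
    rw [ontoStack_append, ontoStack_append, exec_popWord]
    refine ⟨_, rfl, ?_⟩
    rw [← List.append_nil (pushWord 1 r)]
    exact (exec_pushWord_one _).2 rfl
  refine ⟨d.length + 1 + d.length, by simp only [List.length_append]; omega, ?_⟩
  rw [ontoStack_append (p ++ l), ontoStack_append (p ++ r)]
  exact ((run_moveLeft d).trans (WRun.of_edge (.relation l r hl hr he) hx)).trans
    (run_moveRight d)

lemma exists_run_of_derives {n : ℕ} {X Y : List B} (h : Derives K n X Y) :
    ∃ m ≤ n * (2 * (X.length + n * K) + 1),
      WRun φ N K c hc m .rewrite (threeStacks [] (ontoStack A X) U)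
        .rewrite (threeStacks [] (ontoStack A Y) U) := by
  induction n generalizing X with
  | zero =>
    cases h
    exact ⟨0, Nat.zero_le _, rfl, rfl⟩
  | succ n ih =>
    obtain ⟨Z, hZ, h⟩ := h
    obtain ⟨m, hm, hrun⟩ := exists_run_of_rStep (φ := φ) (N := N) (hc := hc) (U := U) hZ
    obtain ⟨m', hm', hrun'⟩ := ih h
    refine ⟨m + m', ?_, hrun.trans hrun'⟩
    have hl := hZ.length_le
    have h₁ : n * (2 * (Z.length + n * K) + 1) ≤ n * (2 * (X.length + (n + 1) * K) + 1) :=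
      Nat.mul_le_mul_left _ (by linarith)
    have h₂ : 2 * X.length + 1 ≤ 2 * (X.length + (n + 1) * K) + 1 := by
      have := Nat.zero_le ((n + 1) * K)
      omega
    linarith

lemma run_compare (X : List B) : WRun φ N K c hc X.length
    .compare (threeStacks [] (ontoStack A X) (ontoStack A X)) .compare (threeStacks [] [] []) := by
  induction X using List.reverseRecOn with
  | nil => exact ⟨rfl, rfl⟩
  | append_singleton X b ih =>
    rw [List.length_append, ontoStack_concat]
    exact ⟨_, _, _, .compare b, exec_pop_one.2 ⟨_, rfl, exec_pop_two.2 ⟨_, rfl, rfl⟩⟩, ih⟩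

/-- The accepting run that guesses the words `s` and `t` and follows a derivation of the word for
`u` from the word `s v t`. -/
lemma exists_acceptsIn {u v : List A} {s t : List B} (hs : ∀ b ∈ s, (b : M) ∈ N)
    (ht : ∀ b ∈ t, (b : M) ∈ N) {n : ℕ}
    (h : Derives K n (s ++ v.flatMap φ ++ t) (u.flatMap φ)) :
    ∃ m ≤ u.length + s.length + v.length + t.length + (u.flatMap φ).length + 6 +
        n * (2 * ((s ++ v.flatMap φ ++ t).length + n * K) + 1),
      (witnessMachine φ N K c hc).AcceptsIn (pairWord u v) m := by
  obtain ⟨m, hm, hrun⟩ := exists_run_of_derives (φ := φ) (N := N) (c := c) (hc := hc)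
    (U := ontoStack A (u.flatMap φ)) h
  set U := ontoStack A (u.flatMap φ)
  have r₁ := run_readLeft (N := N) (K := K) (hc := hc)
    (R := ((none :: v.map some).map .inl)) (L := []) (U := []) u
  rw [List.append_nil, ← List.map_append] at r₁
  have r₂ : WRun φ N K c hc 1 .readLeft _ .guessLeft _ := .of_edge .separator
    ((exec_pop_zero (R := (none :: v.map some).map .inl) (L := []) (U := U)).2 ⟨_, rfl, rfl⟩)
  have r₃ := run_guessLeft (φ := φ) (K := K) (hc := hc) (R := (v.map some).map .inl) (L := [])
    (U := U) s hs
  rw [List.append_nil] at r₃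
  have r₄ : WRun φ N K c hc 1 .guessLeft _ .readRight _ := .of_edge .endLeft
    (rfl : threeStacks ((v.map some).map .inl) (ontoStack A s) U = _)
  have r₅ := run_readRight (N := N) (K := K) (hc := hc) (R := []) (L := ontoStack A s) (U := U) v
  rw [List.append_nil, ← ontoStack_append] at r₅
  have r₆ : WRun φ N K c hc 1 .readRight _ .guessRight _ := .of_edge .endInput
    ((exec_empty_zero (R := []) (L := ontoStack A (s ++ v.flatMap φ)) (U := U)).2 ⟨rfl, rfl⟩)
  have r₇ := run_guessRight (φ := φ) (K := K) (hc := hc) (R := [])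
    (L := ontoStack A (s ++ v.flatMap φ)) (U := U) t ht
  rw [← ontoStack_append] at r₇
  have r₈ : WRun φ N K c hc 1 .guessRight _ .rewrite _ := .of_edge .endRight
    (rfl : threeStacks [] (ontoStack A (s ++ v.flatMap φ ++ t)) U = _)
  have r₉ : WRun φ N K c hc 1 .rewrite _ .compare _ := .of_edge .endRewrite
    ((exec_empty_zero (R := []) (L := U) (U := U)).2 ⟨rfl, rfl⟩)
  have r₁₀ := run_compare (φ := φ) (N := N) (K := K) (hc := hc) (u.flatMap φ)
  have r₁₁ : WRun φ N K c hc 1 .compare _ .done _ := .of_edge .accept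
    ((exec_empty_one (R := []) (L := []) (U := [])).2 ⟨rfl, exec_empty_two.2 ⟨rfl, rfl⟩⟩)
  have r := ((((((((((r₁.trans r₂).trans r₃).trans r₄).trans r₅).trans r₆).trans r₇).trans
    r₈).trans hrun).trans r₉).trans r₁₀).trans r₁₁
  refine ⟨_, ?_, threeStacks [] [] [], by rw [initStacks_witnessMachine]; exact r⟩
  omega

end Completeness

/-! ### Solvability of `s v t = u` is in NP -/

section InNP

variable {M : Type u} [Monoid M] {A B : Finset M}

lemma eval_flatMap {φ : A → List B} (hφ : ∀ a, eval (φ a) = (a : M)) (w : List A) :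
    eval (w.flatMap φ) = eval w := by
  induction w with
  | nil => rfl
  | cons a w ih =>
    rw [List.flatMap_cons, eval_append, ih, hφ, ← eval_singleton, ← eval_append]
    rfl

lemma length_flatMap_le {α β : Type*} {φ : α → List β} {c : ℕ} (hc : ∀ a, (φ a).length ≤ c)
    (w : List α) :
    (w.flatMap φ).length ≤ c * w.length := by
  induction w with
  | nil => simp
  | cons a w ih =>
    have := hc a
    rw [List.flatMap_cons, List.length_append, List.length_cons, mul_add]
    omega

lemma mem_of_eval_mem {N : Submonoid M} (hN : ∀ x y, x * y ∈ N → x ∈ N ∧ y ∈ N) {w : List B}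
    (hw : eval w ∈ N) : ∀ b ∈ w, (b : M) ∈ N := by
  intro b hb
  obtain ⟨x, y, rfl⟩ := List.append_of_mem hb
  rw [← List.singleton_append, eval_append, eval_append, eval_singleton] at hw
  exact (hN _ _ (hN _ _ hw).2).1

/-- If `N` is a submonoid closed under taking factors, then it is in NP to decide whether `u` is
obtained from `v` by multiplying with elements of `N` on both sides. -/
theorem relInNP_witness [IsLeftCancelMul M] (hdeg : BoundedIndegree M)
    (hhyp : StronglyHyperbolic M) (N : Submonoid M) (hN : ∀ x y, x * y ∈ N → x ∈ N ∧ y ∈ N)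
    (A : Finset M) : RelInNP A fun x y : M => ∃ s ∈ N, ∃ t ∈ N, s * y * t = x := by
  obtain ⟨B, hB, δ, hδ⟩ := hhyp
  obtain ⟨D, hD⟩ := hδ.hyperbolicWords
  obtain ⟨K, hK⟩ := exists_derives_of_eval_eq hdeg hD
  obtain ⟨C, hC⟩ := exists_minimalWitness_length_le hdeg hD
  choose φ hφ using fun a : A => hB.exists_eval_eq (a : M)
  obtain ⟨c, hc⟩ : ∃ c, ∀ a, (φ a).length ≤ c :=
    ⟨Finset.univ.sup fun a => (φ a).length, fun a =>
      Finset.le_sup (f := fun a => (φ a).length) (Finset.mem_univ a)⟩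
  -- Bounds for the lengths of `s` and `t`, for all words involved, and for the derivation.
  set E := C * (c + 1)
  let len : Polynomial ℕ := Polynomial.C (2 * E + c) * Polynomial.X
  let num : Polynomial ℕ := len * (len + 4) + (len + 2) + len * (len + 4)
  refine (witnessMachine φ N K c hc).inNP _
    (Polynomial.C (1 + 2 * E + c) * Polynomial.X + 6 +
      num * (2 * (len + num * Polynomial.C K) + 1)) ?_ ?_
  · rintro w ⟨u, v, ⟨s, hs, t, ht, he⟩, rfl⟩
    obtain ⟨s, rfl⟩ := hB.exists_eval_eq s
    obtain ⟨t, rfl⟩ := hB.exists_eval_eq t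
    have hw : Witness N (u.flatMap φ) (v.flatMap φ) s t :=
      ⟨hs, ht, by rw [eval_flatMap hφ, eval_flatMap hφ, he]⟩
    obtain ⟨s, t, hmin⟩ := hw.exists_minimal
    obtain ⟨hsl, htl⟩ := hC N hN _ _ _ _ hmin
    obtain ⟨n, hn, hd⟩ := hK (s ++ v.flatMap φ ++ t) (u.flatMap φ)
      (by simpa [mul_assoc] using hmin.eq)
    obtain ⟨m, hm, hacc⟩ := exists_acceptsIn (hc := hc) (mem_of_eval_mem hN hmin.left_mem)
      (mem_of_eval_mem hN hmin.right_mem) hd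
    refine ⟨m, hm.trans ?_, hacc⟩
    have hu := length_flatMap_le hc u
    have hv := length_flatMap_le hc v
    have hlen : (pairWord u v).length = u.length + v.length + 1 := by
      simp [pairWord]; omega
    set ℓ := (pairWord u v).length
    have hsum : (u.flatMap φ).length + (v.flatMap φ).length + 1 ≤ (c + 1) * ℓ := by
      rw [hlen]; nlinarith
    have hE : C * ((u.flatMap φ).length + (v.flatMap φ).length + 1) ≤ E * ℓ := by
      rw [mul_assoc]; exact Nat.mul_le_mul_left _ hsum
    have hX : (s ++ v.flatMap φ ++ t).length ≤ len.eval ℓ := by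
      have : c * v.length ≤ c * ℓ := Nat.mul_le_mul_left _ (by omega)
      simp only [len, Polynomial.eval_mul, Polynomial.eval_C, Polynomial.eval_X,
        List.length_append]
      nlinarith
    have hcu : (u.flatMap φ).length ≤ c * ℓ := hu.trans (Nat.mul_le_mul_left _ (by omega))
    have hU : (u.flatMap φ).length ≤ len.eval ℓ := by
      simp only [len, Polynomial.eval_mul, Polynomial.eval_C, Polynomial.eval_X]
      nlinarith
    have hnum : n ≤ num.eval ℓ := by
      refine hn.trans ?_
      simp only [num, Polynomial.eval_add, Polynomial.eval_mul, Polynomial.eval_ofNat]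
      gcongr
    simp only [Polynomial.eval_add, Polynomial.eval_mul, Polynomial.eval_C, Polynomial.eval_X,
      Polynomial.eval_ofNat, Polynomial.eval_one]
    refine add_le_add (add_le_add ?_ le_rfl) ?_
    · nlinarith
    · gcongr
  · intro w n hn
    obtain ⟨u, v, rfl, h⟩ := exists_witness_of_acceptsIn hn
    rw [eval_flatMap hφ, eval_flatMap hφ] at h
    exact ⟨u, v, h, rfl⟩

end InNP

/-! ### Green's relations -/

section Green

variable {M : Type u} [Monoid M]

lemma greenJLE_iff {x y : M} :
    GreenJLE x y ↔ ∃ s ∈ (⊤ : Submonoid M), ∃ t ∈ (⊤ : Submonoid M), s * y * t = x := by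
  constructor
  · intro h
    obtain ⟨s, t, he⟩ := h (show x ∈ twoSidedIdeal x from ⟨1, 1, by simp⟩)
    exact ⟨s, trivial, t, trivial, he⟩
  · rintro ⟨s, -, t, -, rfl⟩ _ ⟨s', t', rfl⟩
    exact ⟨s' * s, t * t', by simp only [mul_assoc]⟩

/-- In a cancellative monoid `x = s c` and `c = s' x` force `s` and `s'` to be mutually inverse, so
`L`-related elements differ by a unit on the left; likewise on the right for `R`. -/
lemma greenD_iff [IsCancelMul M] {x y : M} : GreenD x y ↔
    ∃ s ∈ IsUnit.submonoid M, ∃ t ∈ IsUnit.submonoid M, s * y * t = x := by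
  constructor
  · rintro ⟨c, hL, hR⟩
    obtain ⟨s, hs⟩ : x ∈ leftIdeal c := hL ▸ ⟨1, one_mul x⟩
    obtain ⟨s', hs'⟩ : c ∈ leftIdeal x := hL.symm ▸ ⟨1, one_mul c⟩
    obtain ⟨t, ht⟩ : c ∈ rightIdeal y := hR ▸ ⟨1, mul_one c⟩
    obtain ⟨t', ht'⟩ : y ∈ rightIdeal c := hR.symm ▸ ⟨1, mul_one y⟩
    refine ⟨s, ⟨⟨s, s', ?_, ?_⟩, rfl⟩, t, ⟨⟨t, t', ?_, ?_⟩, rfl⟩, by rw [mul_assoc, ht, hs]⟩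
    · exact mul_right_cancel (b := x) (by rw [mul_assoc, hs', hs, one_mul])
    · exact mul_right_cancel (b := c) (by rw [mul_assoc, hs, hs', one_mul])
    · exact mul_left_cancel (a := y) (by rw [← mul_assoc, ht, ht', mul_one])
    · exact mul_left_cancel (a := c) (by rw [← mul_assoc, ht', ht, mul_one])
  · rintro ⟨_, ⟨s, rfl⟩, _, ⟨t, rfl⟩, rfl⟩
    refine ⟨y * t, ?_, ?_⟩
    · ext z
      constructor
      · rintro ⟨a, rfl⟩
        exact ⟨a * s, by simp only [mul_assoc]⟩
      · rintro ⟨a, rfl⟩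
        exact ⟨a * ↑s⁻¹, by simp only [mul_assoc, Units.inv_mul_cancel_left]⟩
    · ext z
      constructor
      · rintro ⟨a, rfl⟩
        exact ⟨t * a, by simp only [mul_assoc]⟩
      · rintro ⟨a, rfl⟩
        exact ⟨↑t⁻¹ * a, by simp only [mul_assoc, Units.mul_inv_cancel_left]⟩

lemma mem_unitSubmonoid_of_mul_mem [IsCancelMul M] (x y : M) (h : x * y ∈ IsUnit.submonoid M) :
    x ∈ IsUnit.submonoid M ∧ y ∈ IsUnit.submonoid M := by
  obtain ⟨g, hg⟩ := h
  have h₁ : x * (y * ↑g⁻¹) = 1 := by rw [← mul_assoc, ← hg, Units.mul_inv]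
  have h₂ : ↑g⁻¹ * x * y = 1 := by rw [mul_assoc, ← hg, Units.inv_mul]
  exact ⟨⟨⟨x, y * ↑g⁻¹, h₁, mul_left_cancel (a := x) (by rw [← mul_assoc, h₁, one_mul, mul_one])⟩,
    rfl⟩, ⟨⟨y, ↑g⁻¹ * x, mul_right_cancel (b := ↑g⁻¹ * x * y)
      (by rw [h₂, mul_one, mul_one]; exact mul_left_cancel (a := ↑g⁻¹ * x)
            (by rw [← mul_assoc, h₂, one_mul, mul_one])), h₂⟩, rfl⟩⟩

end Green

end StrongHyp

theorem mainTheorem3 (M : Type u) [Monoid M] [Monoid.FG M] [IsLeftCancelMul M]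
    (hdeg : StrongHyp.BoundedIndegree M) (hhyp : StrongHyp.StronglyHyperbolic M) :
    (∀ A : Finset M, StrongHyp.Generates A →
      StrongHyp.RelInNP A (StrongHyp.GreenJLE : M → M → Prop)) ∧
    (IsCancelMul M → ∀ A : Finset M, StrongHyp.Generates A →
      StrongHyp.RelInNP A (StrongHyp.GreenD : M → M → Prop)) := by
  refine ⟨fun A _ => ?_, fun _ A _ => ?_⟩
  · rw [show (StrongHyp.GreenJLE : M → M → Prop) = _ from
      funext₂ fun _ _ => propext StrongHyp.greenJLE_iff]
    exact StrongHyp.relInNP_witness hdeg hhyp ⊤ (fun _ _ _ => ⟨trivial, trivial⟩) A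
  · rw [show (StrongHyp.GreenD : M → M → Prop) = _ from
      funext₂ fun _ _ => propext StrongHyp.greenD_iff]
    exact StrongHyp.relInNP_witness hdeg hhyp _ StrongHyp.mem_unitSubmonoid_of_mul_mem A
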